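/- Let $\mathbb T=\mathbb R/\mathbb Z$, let $\varepsilon>0$ and let $W\in C^2([0,\infty);[0,\infty))$. For a probability measure $\mu$ on $\mathbb T$ with a Lebesgue density in $H^1(\mathbb T)$, again denoted by $\mu$, define the distribution $$G^\varepsilon(\mu)=\mu W'(\mu)-W(\mu)+\frac{3\varepsilon^2}{2}|\mu_x|^2-\varepsilon^2(\mu\mu_x)_x$$ and the (possibly empty) set $$\mathcal T^\varepsilon(\mu)=\{g\in L^2(\mathbb T): G^\varepsilon(\mu)_x=\sqrt{\mu}\,g \text{ in the sense of distributions}\}.$$ Let $\mathcal G^\varepsilon(\mu)=\inf_{g\in\mathcal T^\varepsilon(\mu)}\|g\|_{L^2(\mathbb T)}\in[0,+\infty]$, with $\inf\varnothing=+\infty$, and let $\mathcal G^\varepsilon(\mu)=+\infty$ for every probability measure $\mu$ on $\mathbb T$ without a density in $H^1(\mathbb T)$. Let $(\mu_n)_{n\in\mathbb N}$ be probability measures on $\mathbb T$ whose densities (continuous representatives) satisfy $\mu_n\in H^2(\mathbb T)$ and $\mu_n\in C^3_{loc}(\{\mu_n>0\})$, and suppose that $\sup_n\|(\mu_n)_x\|_{L^2(\mathbb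 T)}<\infty$ (for probability densities this is the same as being bounded in $H^1(\mathbb T)$). Let $\mu$ be a probability measure on $\mathbb T$ with $d_2(\mu_n,\mu)\to0$, where $d_2$ is the $L^2$-Wasserstein distance, $$d_2^2(\mu,\nu)=\inf_{\pi}\int_{\mathbb T\times\mathbb T}|x-y|^2\,d\pi(x,y),$$ the infimum being over all probability measures $\pi$ on $\mathbb T\times\mathbb T$ with marginals $\mu$ and $\nu$, and $|x-y|$ being the distance in $\mathbb T$. Then $$\liminf_{n\to\infty}\mathcal G^\varepsilon(\mu_n)\ \ge\ \mathcal G^\varepsilon(\mu).$$ -/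

import Mathlib

open MeasureTheory Filter Topology Set
open scoped ENNReal NNReal ContDiff

noncomputable section

namespace ThinFilm

/-- The flat torus `ℝ / ℤ`, with Mathlib's quotient distance and its Lebesgue measure `volume`
(of total mass one). -/
abbrev Torus : Type := UnitAddCircle

/-- Smooth functions on the torus: those whose periodic lift to `ℝ` is smooth. -/
def IsTest (φ : Torus → ℝ) : Prop :=
  ContDiff ℝ ∞ (fun t : ℝ => φ (t : Torus))

/-- The classical derivative of a function on the torus. -/
def torusDeriv (φ : Torus → ℝ) (x : Torus) : ℝ :=
  deriv (fun t : ℝ => φ (x + (t : Torus))) 0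

/-- `h` is the weak (distributional) derivative of `f` on the torus. -/
def HasWeakDeriv (f h : Torus → ℝ) : Prop :=
  Integrable f ∧ Integrable h ∧
    ∀ φ : Torus → ℝ, IsTest φ → ∫ x, f x * torusDeriv φ x = -∫ x, h x * φ x

open Classical in
/-- The weak derivative `f_x` (determined up to null sets); `0` if there is none. -/
def weakDeriv (f : Torus → ℝ) : Torus → ℝ :=
  if h : ∃ f' : Torus → ℝ, HasWeakDeriv f f' then h.choose else 0

theorem hasWeakDeriv_weakDeriv {f f' : Torus → ℝ} (h : HasWeakDeriv f f') :
    HasWeakDeriv f (weakDeriv f) := by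
  have h' : ∃ f' : Torus → ℝ, HasWeakDeriv f f' := ⟨f', h⟩
  unfold weakDeriv
  rw [dif_pos h']
  exact h'.choose_spec

/-- The Sobolev space `H¹` of the torus. -/
def MemH1 (f : Torus → ℝ) : Prop :=
  MemLp f 2 ∧ HasWeakDeriv f (weakDeriv f) ∧ MemLp (weakDeriv f) 2

/-- The Sobolev space `H²` of the torus. -/
def MemH2 (f : Torus → ℝ) : Prop :=
  MemH1 f ∧ MemH1 (weakDeriv f)

/-- The `H¹` seminorm `‖f_x‖_{L²}`. -/
def h1Seminorm (f : Torus → ℝ) : ℝ≥0∞ :=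
  eLpNorm (weakDeriv f) 2

/-- `ρ` is a (nonnegative) density of `μ` with respect to Lebesgue measure. -/
def IsDensity (μ : ProbabilityMeasure Torus) (ρ : Torus → ℝ) : Prop :=
  AEMeasurable ρ ∧ (∀ x, 0 ≤ ρ x) ∧
    (μ : Measure Torus) = volume.withDensity (fun x => ENNReal.ofReal (ρ x))

/-- The Lebesgue density of `μ`, when `μ` is absolutely continuous. -/
def density (μ : ProbabilityMeasure Torus) (x : Torus) : ℝ :=
  ((μ : Measure Torus).rnDeriv volume x).toReal

/-- Transference plans: probability measures on the product with marginals `μ` and `ν`. -/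
def transferencePlans (μ ν : ProbabilityMeasure Torus) :
    Set (ProbabilityMeasure (Torus × Torus)) :=
  {π | (π : Measure (Torus × Torus)).map Prod.fst = μ ∧
       (π : Measure (Torus × Torus)).map Prod.snd = ν}

/-- The quadratic Wasserstein distance `d₂`. -/
def wasserstein (μ ν : ProbabilityMeasure Torus) : ℝ≥0∞ :=
  (⨅ π ∈ transferencePlans μ ν,
    ∫⁻ p, edist p.1 p.2 ^ 2 ∂(π : Measure (Torus × Torus))) ^ (1 / 2 : ℝ)

/-- The derivative of the potential on `[0, ∞)`, one-sided at `0`. -/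
def potentialDeriv (W : ℝ → ℝ) (y : ℝ) : ℝ :=
  derivWithin W (Ici 0) y

/-- For `f ∈ H¹`, the distribution
`G^ε(f) = f W'(f) - W(f) + (3 ε² / 2) |f_x|² - ε² (f f_x)_x`
evaluated at a test function `φ`; the outer derivative of the last term is put on `φ`. -/
def stress (W : ℝ → ℝ) (ε : ℝ) (f φ : Torus → ℝ) : ℝ :=
  (∫ x, (f x * potentialDeriv W (f x) - W (f x) + 3 * ε ^ 2 / 2 * weakDeriv f x ^ 2) * φ x)
    + ε ^ 2 * ∫ x, f x * weakDeriv f x * torusDeriv φ x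

/-- The set `𝒯^ε(f)` of all `g ∈ L²` with `G^ε(f)_x = √f g` in the sense of distributions. -/
def slopeFields (W : ℝ → ℝ) (ε : ℝ) (f : Torus → ℝ) : Set (Torus → ℝ) :=
  {g | MemLp g 2 ∧ ∀ φ : Torus → ℝ, IsTest φ →
    -stress W ε f (torusDeriv φ) = ∫ x, Real.sqrt (f x) * g x * φ x}

open Classical in
/-- The functional `𝒢^ε : 𝒫(𝕋) → [0, ∞]`: the least `L²` norm of an element of `𝒯^ε(μ)`, and
`+∞` if that set is empty (the infimum over the empty set) or if `μ` has no density in `H¹`. -/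
def slope (W : ℝ → ℝ) (ε : ℝ) (μ : ProbabilityMeasure Torus) : ℝ≥0∞ :=
  if (μ : Measure Torus) ≪ volume ∧ MemH1 (density μ) then
    ⨅ g ∈ slopeFields W ε (density μ), eLpNorm g 2
  else ⊤

end ThinFilm

end

/-!
Let `f` be one of the densities, `D = f_x`, and let `T` be the continuous representative of
`f_x² / 2 - f f_xx = (3 / 2) f_x² - (f f_x)_x`, so that `S = P(f) + ε² T` is the stress, where
`P(y) = y W'(y) - W(y)`. The only term of the stress that is not continuous under weak convergence
in `H¹` is `f_x²`; the point is that along a sequence of bounded slope the derivatives `D` converge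
*strongly* in `L²`.

A slope field `g` with `‖g‖ ≤ K` says `S_x = √f g`, which bounds `S` and its modulus of continuity
(`exists_isBoundedProfile`); hence `T` is bounded and equicontinuous. With `v = √f` one has
`v'' = -T / (2 v³)` where `f > 0`, so if `T ≥ c > 0` near a point, then `v` is concave there, and so
strongly that `f` is bounded below at that point, uniformly over the sequence
(`le_sq_of_ode_of_le`, `exists_threshold`). In other words, `T ≤ c` wherever `f` is small. Testing
the definition of `T` with `δ / (f + δ)` gives

  `∫ f_x² δ / (f + δ) ≤ 2 ∫ T δ / (f + δ)`,

whose right-hand side is therefore small for small `δ`, uniformly in `f` (`exists_energy_le`): no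
Dirichlet energy concentrates near the zero set. Away from it, `f_x = (f f_x) / f`, and the fluxes
`f f_x` of a uniformly convergent sequence are Cauchy in `L²`, because their derivatives are bounded
in `L¹` (`IsProfile.integral_flux_sub_sq_le`). Together this is `exists_energy_sub_le`, from which
`exists_subseq_tendsto` follows with Arzelà–Ascoli.

The bound on the slope is passed to the limit by duality: a slope field of norm at most `K` exists
if and only if `|stress (φ')| ≤ K ‖√f φ‖` for all smooth `φ`, and both sides converge
(`exists_mem_slopeFields`, `slope_le_of_forall_exists`).

Absolutely continuous functions on the torus are handled through the predicate `IsPrimitive`, which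
is shown to be equivalent to weak differentiability up to the choice of a representative.
-/

noncomputable section

namespace ThinFilm

/-! ### Integration over the torus through the covering line -/

instance : IsProbabilityMeasure (volume : Measure Torus) :=
  ⟨UnitAddCircle.measure_univ⟩

theorem integral_torus_eq (f : Torus → ℝ) (a : ℝ) :
    ∫ x, f x = ∫ t in a..a + 1, f (t : Torus) :=
  (UnitAddCircle.intervalIntegral_preimage a f).symm

theorem continuous_coe_torus : Continuous (fun t : ℝ => (t : Torus)) :=
  AddCircle.continuous_mk' (1 : ℝ)

theorem coe_add_one (t : ℝ) : ((t + 1 : ℝ) : Torus) = (t : Torus) :=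
  AddCircle.coe_add_period 1 t

/-- Null sets of the torus lift to null sets of the line. -/
theorem ae_lift {p : Torus → Prop} (h : ∀ᵐ x, p x) : ∀ᵐ t : ℝ, p (t : Torus) := by
  have h1 : ∀ n : ℤ, ∀ᵐ t ∂(volume.restrict (Ioc (n : ℝ) (n + 1))), p ((t : ℝ) : Torus) :=
    fun n => (UnitAddCircle.measurePreserving_mk n).quasiMeasurePreserving.ae h
  have h2 := (ae_restrict_iUnion_iff (μ := (volume : Measure ℝ))
    (fun n : ℤ => Ioc (n : ℝ) (n + 1)) (fun t : ℝ => p (t : Torus))).2 h1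
  rwa [iUnion_Ioc_intCast, Measure.restrict_univ] at h2

theorem intervalIntegrable_lift {f : Torus → ℝ} (hf : Integrable f) (a b : ℝ) :
    IntervalIntegrable (fun t : ℝ => f (t : Torus)) volume a b := by
  have hper : Function.Periodic (fun t : ℝ => f (t : Torus)) 1 := fun t => by
    simp only [coe_add_one]
  refine hper.intervalIntegrable₀ one_ne_zero ?_ a b
  rw [intervalIntegrable_iff_integrableOn_Ioc_of_le zero_le_one]
  have := (UnitAddCircle.measurePreserving_mk 0).integrable_comp_of_integrable hf
  simpa [IntegrableOn, Function.comp_def] using this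

theorem integrable_of_continuous {f : Torus → ℝ} (hf : Continuous f) : Integrable f :=
  hf.integrable_of_hasCompactSupport (HasCompactSupport.of_compactSpace f)

theorem memLp_two_of_continuous {f : Torus → ℝ} (hf : Continuous f) : MemLp f 2 :=
  hf.memLp_of_hasCompactSupport (HasCompactSupport.of_compactSpace f)

theorem exists_bound_of_continuous {f : Torus → ℝ} (hf : Continuous f) :
    ∃ B : ℝ, 0 ≤ B ∧ ∀ x, |f x| ≤ B := by
  obtain ⟨B, hB⟩ := isCompact_univ.exists_bound_of_continuousOn hf.continuousOn
  exact ⟨B, (norm_nonneg _).trans (hB 0 (mem_univ _)), fun x => hB x (mem_univ x)⟩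

theorem integrable_mul_continuous {f g : Torus → ℝ} (hf : Integrable f) (hg : Continuous g) :
    Integrable (fun x => f x * g x) := by
  obtain ⟨B, -, hB⟩ := exists_bound_of_continuous hg
  exact hf.mul_bdd hg.aestronglyMeasurable (ae_of_all _ hB)

/-! ### Absolutely continuous functions on the torus -/

/-- `H` is continuous on the torus and is a primitive of the integrable function `h`; equivalently,
`H` is absolutely continuous with almost everywhere derivative `h`. The increments are read on
the covering line, so `h` automatically has mean zero. -/
structure IsPrimitive (H h : Torus → ℝ) : Prop where
  continuous : Continuous H
  integrable : Integrable h
  integral_eq : ∀ a b : ℝ, ∫ t in a..b, h (t : Torus) = H (b : Torus) - H (a : Torus)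

theorem continuous_of_lift {H : Torus → ℝ} (h : Continuous fun t : ℝ => H (t : Torus)) :
    Continuous H :=
  (QuotientAddGroup.isQuotientMap_mk (AddSubgroup.zmultiples (1 : ℝ))).continuous_iff.2 h

theorem isPrimitive_of_hasDerivAt {H h : Torus → ℝ} (hh : Continuous h)
    (hd : ∀ t : ℝ, HasDerivAt (fun t : ℝ => H (t : Torus)) (h (t : Torus)) t) :
    IsPrimitive H h where
  continuous := continuous_of_lift
    (continuous_iff_continuousAt.2 fun t => (hd t).continuousAt)
  integrable := integrable_of_continuous hh
  integral_eq a b := intervalIntegral.integral_eq_sub_of_hasDerivAt (fun t _ => hd t)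
    (intervalIntegrable_lift (integrable_of_continuous hh) a b)

theorem exists_isPrimitive {h : Torus → ℝ} (hh : Integrable h) (h0 : ∫ x, h x = 0) :
    ∃ H, IsPrimitive H h := by
  have hi := intervalIntegrable_lift hh
  have hper : Function.Periodic (fun t : ℝ => ∫ s in (0 : ℝ)..t, h (s : Torus)) 1 := fun t => by
    show ∫ s in (0 : ℝ)..(t + 1), h (s : Torus) = ∫ s in (0 : ℝ)..t, h (s : Torus)
    rw [← intervalIntegral.integral_add_adjacent_intervals (hi 0 t) (hi t (t + 1)),
      ← integral_torus_eq, h0, add_zero]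
  have hH : ∀ t : ℝ, hper.lift (t : Torus) = ∫ s in (0 : ℝ)..t, h (s : Torus) := fun t => rfl
  refine ⟨hper.lift, continuous_of_lift ?_, hh, fun a b => ?_⟩
  · simp only [hH]
    exact intervalIntegral.continuous_primitive hi 0
  · rw [hH, hH, intervalIntegral.integral_interval_sub_left (hi 0 b) (hi 0 a)]

namespace IsPrimitive

variable {H h G g : Torus → ℝ}

theorem lift_eq (hH : IsPrimitive H h) (a t : ℝ) :
    H (t : Torus) = H (a : Torus) + ∫ s in a..t, h (s : Torus) := by
  rw [hH.integral_eq]; ring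

theorem integral_eq_zero (hH : IsPrimitive H h) : ∫ x, h x = 0 := by
  rw [integral_torus_eq h 0, hH.integral_eq, coe_add_one, sub_self]

theorem congr_ae (hH : IsPrimitive H h) (hg : h =ᵐ[volume] g) : IsPrimitive H g where
  continuous := hH.continuous
  integrable := hH.integrable.congr hg
  integral_eq a b := by
    rw [← hH.integral_eq]
    refine intervalIntegral.integral_congr_ae ?_
    filter_upwards [ae_lift hg] with t ht _ using ht.symm

theorem ae_hasDerivAt (hH : IsPrimitive H h) :
    ∀ᵐ t : ℝ, HasDerivAt (fun t : ℝ => H (t : Torus)) (h (t : Torus)) t := by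
  have hloc : LocallyIntegrable (fun t : ℝ => h (t : Torus)) volume :=
    fun t => ⟨Ioc (t - 1) (t + 1), Ioc_mem_nhds (by linarith) (by linarith),
      (intervalIntegrable_iff_integrableOn_Ioc_of_le (by linarith)).1
        (intervalIntegrable_lift hH.integrable _ _)⟩
  filter_upwards [LocallyIntegrable.ae_hasDerivAt_integral hloc] with t ht
  have := (ht 0).const_add (H ((0 : ℝ) : Torus))
  exact this.congr_of_eventuallyEq (Eventually.of_forall fun s => hH.lift_eq 0 s)

theorem hasDerivAt_of_continuousAt (hH : IsPrimitive H h) {t : ℝ}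
    (ht : ContinuousAt (fun t : ℝ => h (t : Torus)) t) :
    HasDerivAt (fun t : ℝ => H (t : Torus)) (h (t : Torus)) t := by
  have hi := intervalIntegrable_lift hH.integrable
  have hm : StronglyMeasurableAtFilter (fun t : ℝ => h (t : Torus)) (𝓝 t) volume :=
    ⟨Ioc (t - 1) (t + 1), Ioc_mem_nhds (by linarith) (by linarith),
      (hi (t - 1) (t + 1)).aestronglyMeasurable⟩
  have := (intervalIntegral.integral_hasDerivAt_right (hi 0 t) hm ht).const_add
    (H ((0 : ℝ) : Torus))
  exact this.congr_of_eventuallyEq (Eventually.of_forall fun s => hH.lift_eq 0 s)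

theorem absolutelyContinuousOnInterval (hH : IsPrimitive H h) (a b : ℝ) :
    AbsolutelyContinuousOnInterval (fun t : ℝ => H (t : Torus)) a b := by
  have h1 := (intervalIntegrable_lift hH.integrable a b
    ).absolutelyContinuousOnInterval_intervalIntegral (c := a) left_mem_uIcc
  have h2 : AbsolutelyContinuousOnInterval (fun _ : ℝ => H (a : Torus)) a b :=
    contDiff_const.contDiffOn.absolutelyContinuousOnInterval
  convert! h2.add h1 using 1
  funext t
  exact hH.lift_eq a t

theorem mul (hH : IsPrimitive H h) (hG : IsPrimitive G g) :
    IsPrimitive (fun x => H x * G x) (fun x => h x * G x + H x * g x) where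
  continuous := hH.continuous.mul hG.continuous
  integrable := (integrable_mul_continuous hH.integrable hG.continuous).add <| by
    simpa only [mul_comm] using integrable_mul_continuous hG.integrable hH.continuous
  integral_eq a b := by
    rw [← AbsolutelyContinuousOnInterval.integral_deriv_mul_eq_sub
      (hH.absolutelyContinuousOnInterval a b) (hG.absolutelyContinuousOnInterval a b)]
    refine intervalIntegral.integral_congr_ae ?_
    filter_upwards [hH.ae_hasDerivAt, hG.ae_hasDerivAt] with t h1 h2 _
    rw [h1.deriv, h2.deriv]

theorem sub (hH : IsPrimitive H h) (hG : IsPrimitive G g) :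
    IsPrimitive (fun x => H x - G x) (fun x => h x - g x) where
  continuous := hH.continuous.sub hG.continuous
  integrable := hH.integrable.sub hG.integrable
  integral_eq a b := by
    rw [intervalIntegral.integral_sub (intervalIntegrable_lift hH.integrable a b)
      (intervalIntegrable_lift hG.integrable a b), hH.integral_eq, hG.integral_eq]
    ring

theorem integral_mul_eq_neg (hH : IsPrimitive H h) (hG : IsPrimitive G g) :
    ∫ x, H x * g x = -∫ x, h x * G x := by
  have h1 := (hH.mul hG).integral_eq_zero
  rw [integral_add (integrable_mul_continuous hH.integrable hG.continuous)] at h1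
  · linarith
  · simpa only [mul_comm] using integrable_mul_continuous hG.integrable hH.continuous

end IsPrimitive

/-! ### Test functions and weak derivatives -/

theorem torusDeriv_coe (φ : Torus → ℝ) (t : ℝ) :
    torusDeriv φ (t : Torus) = deriv (fun s : ℝ => φ (s : Torus)) t := by
  have h : (fun s : ℝ => φ ((t : Torus) + (s : Torus)))
      = fun s : ℝ => (fun r : ℝ => φ (r : Torus)) (t + s) := by
    funext s; simp
  rw [torusDeriv, h, deriv_comp_const_add (fun r : ℝ => φ (r : Torus)) t 0, add_zero]

namespace IsTest

variable {φ ψ : Torus → ℝ}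

theorem continuous (h : IsTest φ) : Continuous φ :=
  continuous_of_lift (ContDiff.continuous h)

theorem hasDerivAt (h : IsTest φ) (t : ℝ) :
    HasDerivAt (fun t : ℝ => φ (t : Torus)) (torusDeriv φ (t : Torus)) t := by
  rw [torusDeriv_coe]
  exact ((contDiff_infty_iff_deriv.1 h).1 t).hasDerivAt

theorem torusDeriv (h : IsTest φ) : IsTest (torusDeriv φ) := by
  have := (contDiff_infty_iff_deriv.1 h).2
  have h2 : (fun t : ℝ => ThinFilm.torusDeriv φ (t : Torus)) = deriv (fun s : ℝ => φ (s : Torus)) :=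
    funext (torusDeriv_coe φ)
  unfold IsTest
  rwa [h2]

theorem isPrimitive (h : IsTest φ) : IsPrimitive φ (ThinFilm.torusDeriv φ) :=
  isPrimitive_of_hasDerivAt h.torusDeriv.continuous h.hasDerivAt

theorem add (h : IsTest φ) (h' : IsTest ψ) : IsTest (φ + ψ) :=
  ContDiff.add h h'

theorem mul (h : IsTest φ) (h' : IsTest ψ) : IsTest (φ * ψ) :=
  ContDiff.mul h h'

theorem const (c : ℝ) : IsTest (fun _ => c) :=
  contDiff_const

theorem const_smul (c : ℝ) (h : IsTest φ) : IsTest (c • φ) :=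
  (IsTest.const c).mul h

theorem torusDeriv_add (h : IsTest φ) (h' : IsTest ψ) :
    ThinFilm.torusDeriv (φ + ψ) = ThinFilm.torusDeriv φ + ThinFilm.torusDeriv ψ := by
  funext x
  obtain ⟨t, rfl⟩ := QuotientAddGroup.mk_surjective x
  exact (((h.hasDerivAt t).add (h'.hasDerivAt t)).unique ((h.add h').hasDerivAt t)).symm

theorem torusDeriv_const_smul (c : ℝ) (h : IsTest φ) :
    ThinFilm.torusDeriv (c • φ) = c • ThinFilm.torusDeriv φ := by
  funext x
  obtain ⟨t, rfl⟩ := QuotientAddGroup.mk_surjective x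
  exact (((h.hasDerivAt t).const_mul c).unique ((h.const_smul c).hasDerivAt t)).symm

/-- A smooth function of mean zero is the derivative of a smooth function. -/
theorem exists_eq_torusDeriv (h : IsTest φ) (h0 : ∫ x, φ x = 0) :
    ∃ ψ, IsTest ψ ∧ ThinFilm.torusDeriv ψ = φ := by
  obtain ⟨ψ, hψ⟩ := exists_isPrimitive (integrable_of_continuous h.continuous) h0
  have hd : ∀ t : ℝ, HasDerivAt (fun t : ℝ => ψ (t : Torus)) (φ (t : Torus)) t := fun t =>
    hψ.hasDerivAt_of_continuousAt (h.continuous.comp continuous_coe_torus).continuousAt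
  have hde : deriv (fun t : ℝ => ψ (t : Torus)) = fun t : ℝ => φ (t : Torus) :=
    funext fun t => (hd t).deriv
  refine ⟨ψ, contDiff_infty_iff_deriv.2 ⟨fun t => (hd t).differentiableAt, ?_⟩, ?_⟩
  · rw [hde]; exact h
  · funext x
    obtain ⟨t, rfl⟩ := QuotientAddGroup.mk_surjective x
    exact (torusDeriv_coe ψ t).trans (hd t).deriv

end IsTest

/-- The smooth functions, as a subalgebra of the continuous functions on the torus. -/
def testSubalgebra : Subalgebra ℝ C(Torus, ℝ) where
  carrier := {φ | IsTest φ}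
  mul_mem' h h' := IsTest.mul h h'
  add_mem' h h' := IsTest.add h h'
  algebraMap_mem' c := IsTest.const c

theorem testSubalgebra_separatesPoints : testSubalgebra.SeparatesPoints := by
  intro x y hxy
  have hre : IsTest (fun x => ((AddCircle.toCircle x : Circle) : ℂ).re) := by
    have : (fun t : ℝ => ((AddCircle.toCircle (t : Torus) : Circle) : ℂ).re)
        = fun t : ℝ => Real.cos (2 * Real.pi / 1 * t) := by
      funext t
      rw [AddCircle.toCircle_apply_mk, Circle.coe_exp, Complex.exp_ofReal_mul_I_re]
    unfold IsTest
    rw [this]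
    exact Real.contDiff_cos.comp (contDiff_const.mul contDiff_id)
  have him : IsTest (fun x => ((AddCircle.toCircle x : Circle) : ℂ).im) := by
    have : (fun t : ℝ => ((AddCircle.toCircle (t : Torus) : Circle) : ℂ).im)
        = fun t : ℝ => Real.sin (2 * Real.pi / 1 * t) := by
      funext t
      rw [AddCircle.toCircle_apply_mk, Circle.coe_exp, Complex.exp_ofReal_mul_I_im]
    unfold IsTest
    rw [this]
    exact Real.contDiff_sin.comp (contDiff_const.mul contDiff_id)
  have hne : ((AddCircle.toCircle x : Circle) : ℂ) ≠ ((AddCircle.toCircle y : Circle) : ℂ) :=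
    fun h => hxy (AddCircle.injective_toCircle one_ne_zero (Circle.coe_injective h))
  by_cases h : ((AddCircle.toCircle x : Circle) : ℂ).re = ((AddCircle.toCircle y : Circle) : ℂ).re
  · exact ⟨_, ⟨⟨_, him.continuous⟩, him, rfl⟩, fun h' => hne (Complex.ext h h')⟩
  · exact ⟨_, ⟨⟨_, hre.continuous⟩, hre, rfl⟩, h⟩

theorem exists_isTest_near {f : Torus → ℝ} (hf : Continuous f) {δ : ℝ} (hδ : 0 < δ) :
    ∃ φ, IsTest φ ∧ ∀ x, |φ x - f x| < δ := by
  obtain ⟨φ, hφ⟩ := ContinuousMap.exists_mem_subalgebra_near_continuous_of_separatesPoints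
    testSubalgebra testSubalgebra_separatesPoints f hf δ hδ
  exact ⟨φ, φ.2, hφ⟩

/-- The fundamental lemma of the calculus of variations on the torus. -/
theorem ae_eq_zero_of_forall_isTest {u : Torus → ℝ} (hu : Integrable u)
    (h : ∀ φ, IsTest φ → ∫ x, u x * φ x = 0) : u =ᵐ[volume] 0 := by
  have hc : ∀ f : Torus → ℝ, Continuous f → ∫ x, u x * f x = 0 := by
    intro f hf
    refine abs_eq_zero.1 (le_antisymm (le_of_forall_pos_le_add fun η hη => ?_) (abs_nonneg _))
    set A := ∫ x, |u x| with hA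
    have hA0 : 0 ≤ A := integral_nonneg fun x => abs_nonneg _
    obtain ⟨φ, hφ, hφf⟩ := exists_isTest_near hf (δ := η / (A + 1)) (by positivity)
    have h1 : ∫ x, u x * f x = ∫ x, u x * (f x - φ x) := by
      simp only [mul_sub]
      rw [integral_sub (integrable_mul_continuous hu hf)
        (integrable_mul_continuous hu hφ.continuous), h φ hφ, sub_zero]
    rw [h1, zero_add]
    calc |∫ x, u x * (f x - φ x)| ≤ ∫ x, |u x * (f x - φ x)| := abs_integral_le_integral_abs
      _ ≤ ∫ x, |u x| * (η / (A + 1)) := by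
        refine integral_mono (integrable_mul_continuous hu (hf.sub hφ.continuous)).abs
          (hu.abs.mul_const _) fun x => ?_
        show |u x * (f x - φ x)| ≤ |u x| * (η / (A + 1))
        rw [abs_mul, abs_sub_comm]
        exact mul_le_mul_of_nonneg_left (hφf x).le (abs_nonneg _)
      _ = A * (η / (A + 1)) := integral_mul_const _ _
      _ ≤ η := by
        rw [mul_div_assoc', div_le_iff₀ (by positivity)]
        nlinarith
  refine ae_eq_zero_of_forall_setIntegral_isClosed_eq_zero hu fun s hs => ?_
  have hlim : Tendsto (fun n => ∫ x, u x * ((hs.apprSeq n x : ℝ≥0) : ℝ)) atTop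
      (𝓝 (∫ x in s, u x)) := by
    rw [← integral_indicator hs.measurableSet]
    refine tendsto_integral_of_dominated_convergence (fun x => |u x|) (fun n => ?_) hu.abs
      (fun n => ?_) ?_
    · exact hu.aestronglyMeasurable.mul
        (NNReal.continuous_coe.comp (hs.apprSeq n).continuous).aestronglyMeasurable
    · refine ae_of_all _ fun x => ?_
      have h1 : ((hs.apprSeq n x : ℝ≥0) : ℝ) ≤ 1 := by
        exact_mod_cast HasOuterApproxClosed.apprSeq_apply_le_one hs n x
      rw [Real.norm_eq_abs, abs_mul, abs_of_nonneg (NNReal.coe_nonneg _)]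
      exact mul_le_of_le_one_right (abs_nonneg _) h1
    · refine ae_of_all _ fun x => ?_
      have h1 := (tendsto_pi_nhds.1 (HasOuterApproxClosed.tendsto_apprSeq hs)) x
      have h2 := (NNReal.tendsto_coe.2 h1).const_mul (u x)
      convert! h2 using 2
      by_cases hx : x ∈ s <;> simp [hx]
  refine tendsto_nhds_unique hlim ?_
  have : ∀ n, ∫ x, u x * ((hs.apprSeq n x : ℝ≥0) : ℝ) = 0 := fun n =>
    hc _ (NNReal.continuous_coe.comp (hs.apprSeq n).continuous)
  simp only [this]
  exact tendsto_const_nhds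

theorem HasWeakDeriv.congr_ae {f f' h h' : Torus → ℝ} (H : HasWeakDeriv f h)
    (hf : f =ᵐ[volume] f') (hh : h =ᵐ[volume] h') : HasWeakDeriv f' h' := by
  refine ⟨H.1.congr hf, H.2.1.congr hh, fun φ hφ => ?_⟩
  have h1 : ∫ x, f x * torusDeriv φ x = ∫ x, f' x * torusDeriv φ x :=
    integral_congr_ae (hf.mono fun x hx => by simp only [hx])
  have h2 : ∫ x, h x * φ x = ∫ x, h' x * φ x :=
    integral_congr_ae (hh.mono fun x hx => by simp only [hx])
  rw [← h1, ← h2]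
  exact H.2.2 φ hφ

theorem HasWeakDeriv.ae_unique {f h h' : Torus → ℝ} (H : HasWeakDeriv f h)
    (H' : HasWeakDeriv f h') : h =ᵐ[volume] h' := by
  have : (fun x => h x - h' x) =ᵐ[volume] 0 := by
    refine ae_eq_zero_of_forall_isTest (H.2.1.sub H'.2.1) fun φ hφ => ?_
    have h1 := H.2.2 φ hφ
    have h2 := H'.2.2 φ hφ
    simp only [sub_mul]
    rw [integral_sub (integrable_mul_continuous H.2.1 hφ.continuous)
      (integrable_mul_continuous H'.2.1 hφ.continuous)]
    linarith
  filter_upwards [this] with x hx using sub_eq_zero.1 hx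

theorem IsPrimitive.hasWeakDeriv {H h : Torus → ℝ} (hH : IsPrimitive H h) : HasWeakDeriv H h :=
  ⟨integrable_of_continuous hH.continuous, hH.integrable,
    fun _ hφ => hH.integral_mul_eq_neg hφ.isPrimitive⟩

/-- A function with a weak derivative agrees almost everywhere with a primitive of it. -/
theorem HasWeakDeriv.exists_isPrimitive {f h : Torus → ℝ} (H : HasWeakDeriv f h) :
    ∃ F, f =ᵐ[volume] F ∧ IsPrimitive F h := by
  have h0 : ∫ x, h x = 0 := by
    have h1 := H.2.2 (fun _ => 1) (IsTest.const 1)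
    have h2 : torusDeriv (fun _ => (1 : ℝ)) = fun _ => 0 := by
      funext x; simp [torusDeriv]
    simpa [h2] using h1
  obtain ⟨F, hF⟩ := ThinFilm.exists_isPrimitive H.2.1 h0
  have hFi := integrable_of_continuous hF.continuous
  have hu : Integrable (fun x => f x - F x) := H.1.sub hFi
  set c := ∫ x, (f x - F x) with hc
  have key : (fun x => f x - F x - c) =ᵐ[volume] 0 := by
    refine ae_eq_zero_of_forall_isTest (hu.sub (integrable_const c)) fun φ hφ => ?_
    set m := ∫ x, φ x with hm
    have hφi := integrable_of_continuous hφ.continuous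
    obtain ⟨ψ, hψ, hψφ⟩ := IsTest.exists_eq_torusDeriv (φ := φ + fun _ => -m)
      (hφ.add (IsTest.const (-m))) (by
        show ∫ x, (φ x + -m) = 0
        rw [integral_add hφi (integrable_const _)]; simp [hm])
    have h1 := H.2.2 ψ hψ
    have h2 := hF.hasWeakDeriv.2.2 ψ hψ
    rw [hψφ] at h1 h2
    simp only [Pi.add_apply] at h1 h2
    have hcont : Continuous (fun x => φ x + -m) := hφ.continuous.add continuous_const
    have h3 : ∫ x, (f x - F x) * (φ x + -m) = 0 := by
      simp only [sub_mul]
      rw [integral_sub (integrable_mul_continuous H.1 hcont)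
        (integrable_mul_continuous hFi hcont), h1, h2, sub_self]
    have h4 : ∫ x, (f x - F x) * (φ x + -m)
        = (∫ x, (f x - F x) * φ x) - m * c := by
      have : ∀ x, (f x - F x) * (φ x + -m) = (f x - F x) * φ x - m * (f x - F x) := by
        intro x; ring
      simp only [this]
      rw [integral_sub (integrable_mul_continuous hu hφ.continuous) (hu.const_mul m),
        integral_const_mul]
    have h5 : ∫ x, (f x - F x - c) * φ x = (∫ x, (f x - F x) * φ x) - c * m := by
      simp only [sub_mul _ c]
      rw [integral_sub (integrable_mul_continuous hu hφ.continuous) (hφi.const_mul c),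
        integral_const_mul]
    rw [h5]; linarith
  refine ⟨fun x => F x + c, ?_, hF.continuous.add continuous_const, hF.integrable, fun a b => ?_⟩
  · filter_upwards [key] with x hx
    have : f x - F x - c = 0 := hx
    linarith
  · rw [hF.integral_eq]; ring

/-! ### Lower bounds where the stress is large -/

/-- If `F F'' = F'² / 2 - T` where `F ≥ 0` is positive and `T ≥ c > 0` on an interval, then `F`
has no zero there: next to a zero, where `F'` vanishes as well, `F` would be strictly concave. -/
theorem pos_of_ode_of_le {F D T : ℝ → ℝ} {c a b : ℝ} (hF0 : ∀ t, 0 ≤ F t)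
    (hF : ∀ t, HasDerivAt F (D t) t) (hD : Continuous D)
    (hode : ∀ t, 0 < F t → HasDerivAt D ((D t ^ 2 / 2 - T t) / F t) t)
    (hzero : ∀ t, (∀ᶠ s in 𝓝 t, F s = 0) → T t = 0)
    (hc : 0 < c) (hT : ∀ t ∈ Ico a b, c ≤ T t) {y : ℝ} (hy : y ∈ Ico a b) : 0 < F y := by
  have hFc : Continuous F := continuous_iff_continuousAt.2 fun t => (hF t).continuousAt
  have hcrit : ∀ t, F t = 0 → D t = 0 := fun t ht =>
    IsLocalMin.hasDerivAt_eq_zero (Eventually.of_forall fun s => by rw [ht]; exact hF0 s) (hF t)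
  refine lt_of_le_of_ne (hF0 y) fun hy0 => ?_
  have hDy : D y = 0 := hcrit y hy0.symm
  have hnear : ∀ᶠ t in 𝓝 y, D t ^ 2 / 2 < c := by
    have : ContinuousAt (fun t => D t ^ 2 / 2) y := by fun_prop
    exact this.eventually (Iio_mem_nhds (by simpa [hDy] using hc))
  obtain ⟨σ, hσ, hball⟩ := Metric.eventually_nhds_iff.1 hnear
  -- `F` vanishes on an interval to the right of `y`
  set z := min (y + σ) b with hz
  have hyz : y < z := lt_min (by linarith) hy.2
  have hsmall : ∀ t ∈ Ico y z, D t ^ 2 / 2 < T t := by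
    intro t ht
    have h1 : t < y + σ := ht.2.trans_le (min_le_left _ _)
    have h2 : t < b := ht.2.trans_le (min_le_right _ _)
    refine lt_of_lt_of_le (hball ?_) (hT t ⟨hy.1.trans ht.1, h2⟩)
    rw [Real.dist_eq, abs_of_nonneg (by linarith [ht.1])]; linarith
  have hvan : ∀ s ∈ Ioo y z, F s = 0 := by
    intro s hs
    by_contra hne
    have hpos : 0 < F s := lt_of_le_of_ne (hF0 s) (Ne.symm hne)
    -- the last zero of `F` before `s`
    have hK : IsCompact (Icc y s ∩ {t | F t = 0}) :=
      isCompact_Icc.inter_right (isClosed_singleton.preimage hFc)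
    obtain ⟨p, hp⟩ := hK.exists_isGreatest ⟨y, left_mem_Icc.2 hs.1.le, hy0.symm⟩
    have hp0 : F p = 0 := hp.1.2
    have hyp : y ≤ p := hp.1.1.1
    have hps : p < s := lt_of_le_of_ne hp.1.1.2 fun h => hne (h ▸ hp0)
    have hposI : ∀ t ∈ Ioc p s, 0 < F t := fun t ht =>
      lt_of_le_of_ne (hF0 t) fun h =>
        absurd (hp.2 ⟨⟨hyp.trans ht.1.le, ht.2⟩, h.symm⟩) (not_le.2 ht.1)
    have hDanti : StrictAntiOn D (Icc p s) := by
      refine strictAntiOn_of_deriv_neg (convex_Icc p s) hD.continuousOn fun t ht => ?_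
      rw [interior_Icc] at ht
      have hFt := hposI t ⟨ht.1, ht.2.le⟩
      rw [(hode t hFt).deriv]
      have := hsmall t ⟨hyp.trans ht.1.le, ht.2.trans hs.2⟩
      exact div_neg_of_neg_of_pos (by linarith) hFt
    have hFanti : StrictAntiOn F (Icc p s) := by
      refine strictAntiOn_of_deriv_neg (convex_Icc p s) hFc.continuousOn fun t ht => ?_
      rw [interior_Icc] at ht
      rw [(hF t).deriv, ← hcrit p hp0]
      exact hDanti (left_mem_Icc.2 hps.le) ⟨ht.1.le, ht.2.le⟩ ht.1
    have := hFanti (left_mem_Icc.2 hps.le) (right_mem_Icc.2 hps.le) hps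
    rw [hp0] at this
    linarith
  have hmid : (y + z) / 2 ∈ Ioo y z := ⟨by linarith, by linarith⟩
  have h1 := hzero _ (Filter.eventually_of_mem (isOpen_Ioo.mem_nhds hmid) hvan)
  have h2 := hT ((y + z) / 2) ⟨by linarith [hy.1, hmid.1],
    hmid.2.trans_le (min_le_right _ _)⟩
  linarith

/-- Quantitative version: `F` is bounded below at the centre of an interval on which `T ≥ c`.
In terms of `v = √F` the equation reads `v'' = -T / (2 v³)`, so `v` is concave, hence at most
twice its central value, and this in turn makes `v` so concave that its central value cannot be
small. -/
theorem le_sq_of_ode_of_le {F D T : ℝ → ℝ} {c r x : ℝ} (hF0 : ∀ t, 0 ≤ F t)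
    (hF : ∀ t, HasDerivAt F (D t) t) (hD : Continuous D)
    (hode : ∀ t, 0 < F t → HasDerivAt D ((D t ^ 2 / 2 - T t) / F t) t)
    (hzero : ∀ t, (∀ᶠ s in 𝓝 t, F s = 0) → T t = 0)
    (hc : 0 < c) (hr : 0 < r) (hT : ∀ t ∈ Icc (x - r) (x + r), c ≤ T t) :
    c * r ^ 2 / 32 ≤ F x ^ 2 := by
  have hFc : Continuous F := continuous_iff_continuousAt.2 fun t => (hF t).continuousAt
  have hpos : ∀ t ∈ Ico (x - r) (x + r), 0 < F t := fun t ht =>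
    pos_of_ode_of_le hF0 hF hD hode hzero hc (fun s hs => hT s ⟨hs.1, hs.2.le⟩) ht
  set v : ℝ → ℝ := fun t => √(F t) with hv
  have hvc : Continuous v := hFc.sqrt
  have hv0 : ∀ t, 0 ≤ v t := fun t => Real.sqrt_nonneg _
  have hvpos : ∀ t ∈ Ico (x - r) (x + r), 0 < v t := fun t ht => Real.sqrt_pos.2 (hpos t ht)
  have hvsq : ∀ t, F t = v t ^ 2 := fun t => (Real.sq_sqrt (hF0 t)).symm
  have hd1 : ∀ t ∈ Ioo (x - r) (x + r), HasDerivAt v (D t / (2 * v t)) t := fun t ht =>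
    (hF t).sqrt (hpos t ⟨ht.1.le, ht.2⟩).ne'
  have hd2 : ∀ t ∈ Ioo (x - r) (x + r),
      HasDerivAt (fun t => D t / (2 * v t)) (-(T t / (2 * v t ^ 3))) t := by
    intro t ht
    have hvt := hvpos t ⟨ht.1.le, ht.2⟩
    have h := (hode t (hpos t ⟨ht.1.le, ht.2⟩)).fun_div ((hd1 t ht).const_mul 2)
      (mul_pos two_pos hvt).ne'
    convert! h using 1
    rw [hvsq t]
    field_simp
    ring
  have hint : interior (Icc (x - r) (x + r)) = Ioo (x - r) (x + r) := interior_Icc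
  have hconc : ConcaveOn ℝ (Icc (x - r) (x + r)) v := by
    refine concaveOn_of_hasDerivWithinAt2_nonpos (convex_Icc _ _) hvc.continuousOn
      (f' := fun t => D t / (2 * v t)) (f'' := fun t => -(T t / (2 * v t ^ 3))) ?_ ?_ ?_
    · exact fun t ht => (hd1 t (hint ▸ ht)).hasDerivWithinAt
    · exact fun t ht => (hd2 t (hint ▸ ht)).hasDerivWithinAt
    · intro t ht
      rw [hint] at ht
      have h1 := hT t ⟨ht.1.le, ht.2.le⟩
      have h2 := hvpos t ⟨ht.1.le, ht.2⟩
      have : 0 ≤ T t := hc.le.trans h1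
      simp only [Left.neg_nonpos_iff]
      positivity
  have hxI : x ∈ Ico (x - r) (x + r) := ⟨by linarith, by linarith⟩
  have hvx := hvpos x hxI
  have hle : ∀ t ∈ Icc (x - r) (x + r), v t ≤ 2 * v x := by
    intro t ht
    have ht' : 2 * x - t ∈ Icc (x - r) (x + r) := ⟨by linarith [ht.2], by linarith [ht.1]⟩
    have h := hconc.2 ht ht' (by norm_num : (0 : ℝ) ≤ 1 / 2) (by norm_num : (0 : ℝ) ≤ 1 / 2)
      (by norm_num)
    have hx : (1 / 2 : ℝ) • t + (1 / 2 : ℝ) • (2 * x - t) = x := by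
      simp only [smul_eq_mul]; ring
    rw [hx] at h
    simp only [smul_eq_mul] at h
    linarith [hv0 (2 * x - t)]
  set k : ℝ := c / (32 * v x ^ 3) with hk
  have hconc2 : ConcaveOn ℝ (Icc (x - r) (x + r)) (fun t => v t + k * (t - x) ^ 2) := by
    refine concaveOn_of_hasDerivWithinAt2_nonpos (convex_Icc _ _)
      (by fun_prop)
      (f' := fun t => D t / (2 * v t) + k * (2 * (t - x)))
      (f'' := fun t => -(T t / (2 * v t ^ 3)) + k * 2) ?_ ?_ ?_
    · intro t ht
      have h1 : HasDerivAt (fun t => k * (t - x) ^ 2) (k * (2 * (t - x))) t := by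
        have := (((hasDerivAt_id t).sub_const x).fun_pow 2).const_mul k
        simpa using this
      exact ((hd1 t (hint ▸ ht)).add h1).hasDerivWithinAt
    · intro t ht
      have h1 : HasDerivAt (fun t => k * (2 * (t - x))) (k * 2) t := by
        have := (((hasDerivAt_id t).sub_const x).const_mul 2).const_mul k
        simpa using this
      exact ((hd2 t (hint ▸ ht)).add h1).hasDerivWithinAt
    · intro t ht
      rw [hint] at ht
      have h1 := hT t ⟨ht.1.le, ht.2.le⟩
      have h2 := hvpos t ⟨ht.1.le, ht.2⟩
      have h3 := hle t ⟨ht.1.le, ht.2.le⟩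
      have h4 : v t ^ 3 ≤ (2 * v x) ^ 3 := pow_le_pow_left₀ h2.le h3 3
      have h5 : k * 2 ≤ T t / (2 * v t ^ 3) := by
        have h6 : k * 2 = c / (2 * (2 * v x) ^ 3) := by
          rw [hk]; field_simp; ring
        rw [h6]
        exact div_le_div₀ (hc.le.trans h1) h1 (by positivity) (by linarith)
      linarith
  have hl : x - r ∈ Icc (x - r) (x + r) := ⟨le_rfl, by linarith⟩
  have hr' : x + r ∈ Icc (x - r) (x + r) := ⟨by linarith, le_rfl⟩
  have h := hconc2.2 hl hr' (by norm_num : (0 : ℝ) ≤ 1 / 2) (by norm_num : (0 : ℝ) ≤ 1 / 2)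
    (by norm_num)
  have hx : (1 / 2 : ℝ) • (x - r) + (1 / 2 : ℝ) • (x + r) = x := by
    simp only [smul_eq_mul]; ring
  rw [hx] at h
  simp only [smul_eq_mul] at h
  have h6 : k * r ^ 2 ≤ v x := by nlinarith [hv0 (x - r), hv0 (x + r)]
  rw [hk, div_mul_eq_mul_div, div_le_iff₀ (by positivity)] at h6
  rw [hvsq x]
  nlinarith

/-! ### Profiles: nonnegative functions of class `H²` -/

/-- A nonnegative profile `f` with continuous derivative `D`, second derivative `h`, and with `T`
the continuous representative of `f_x² / 2 - f f_xx`, which is the part of the stress that stems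
from surface tension (up to the factor `ε²`). -/
structure IsProfile (f D h T : Torus → ℝ) : Prop where
  nonneg : ∀ x, 0 ≤ f x
  prim : IsPrimitive f D
  prim2 : IsPrimitive D h
  cont : Continuous T
  ae_eq : T =ᵐ[volume] fun x => D x ^ 2 / 2 - f x * h x

namespace IsProfile

variable {f D h T : Torus → ℝ}

theorem hasDerivAt (hp : IsProfile f D h T) (t : ℝ) :
    HasDerivAt (fun t : ℝ => f (t : Torus)) (D (t : Torus)) t :=
  hp.prim.hasDerivAt_of_continuousAt (hp.prim2.continuous.comp continuous_coe_torus).continuousAt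

/-- Where the profile is positive, its derivative is classically differentiable, since the
equation `f f_xx = f_x² / 2 - T` gives `f_xx` a continuous representative. -/
theorem hasDerivAt2 (hp : IsProfile f D h T) {t : ℝ} (ht : 0 < f (t : Torus)) :
    HasDerivAt (fun t : ℝ => D (t : Torus))
      ((D (t : Torus) ^ 2 / 2 - T (t : Torus)) / f (t : Torus)) t := by
  have hfc : Continuous fun t : ℝ => f (t : Torus) :=
    hp.prim.continuous.comp continuous_coe_torus
  have hDc : Continuous fun t : ℝ => D (t : Torus) :=
    hp.prim2.continuous.comp continuous_coe_torus
  have hTc : Continuous fun t : ℝ => T (t : Torus) := hp.cont.comp continuous_coe_torus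
  -- near `t` the second derivative agrees almost everywhere with a continuous function
  obtain ⟨σ, hσ, hball⟩ := Metric.eventually_nhds_iff.1
    (hfc.continuousAt.eventually (lt_mem_nhds ht))
  set k : ℝ → ℝ := fun s => (D (s : Torus) ^ 2 / 2 - T (s : Torus)) / f (s : Torus) with hk
  have hkc : ContinuousOn k (Metric.ball t σ) :=
    ContinuousOn.div (((hDc.pow 2).div_const 2).sub hTc).continuousOn hfc.continuousOn
      fun s hs => (hball hs).ne'
  have hball_conv := convex_ball t σ
  have hsub : ∀ s ∈ Metric.ball t σ, uIcc t s ⊆ Metric.ball t σ := fun s hs => by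
    rw [← segment_eq_uIcc]
    exact hball_conv.segment_subset (Metric.mem_ball_self hσ) hs
  have heq : ∀ s ∈ Metric.ball t σ,
      D (s : Torus) = D (t : Torus) + ∫ u in t..s, k u := by
    intro s hs
    rw [hp.prim2.lift_eq t s]
    congr 1
    refine intervalIntegral.integral_congr_ae ?_
    filter_upwards [ae_lift hp.ae_eq] with u hu hus
    have hfu := hball (hsub s hs (uIoc_subset_uIcc hus))
    rw [hk]
    simp only
    rw [eq_div_iff hfu.ne', hu]
    ring
  have hkt : ContinuousAt k t := hkc.continuousAt (Metric.ball_mem_nhds t hσ)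
  have hmeas : StronglyMeasurableAtFilter k (𝓝 t) volume :=
    hkc.stronglyMeasurableAtFilter Metric.isOpen_ball t (Metric.mem_ball_self hσ)
  have hder := (intervalIntegral.integral_hasDerivAt_right
    IntervalIntegrable.refl hmeas hkt).const_add (D (t : Torus))
  exact hder.congr_of_eventuallyEq
    (Filter.eventually_of_mem (Metric.ball_mem_nhds t hσ) heq)

/-- `T` vanishes in the interior of the zero set. -/
theorem T_eq_zero (hp : IsProfile f D h T) {t : ℝ}
    (ht : ∀ᶠ s in 𝓝 t, f ((s : ℝ) : Torus) = 0) : T (t : Torus) = 0 := by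
  have hTc : Continuous fun t : ℝ => T (t : Torus) := hp.cont.comp continuous_coe_torus
  obtain ⟨U, hU, hUo, htU⟩ := eventually_nhds_iff.1 ht
  have h1 : ∀ᵐ s ∂(volume.restrict U), T ((s : ℝ) : Torus) = (fun _ => (0 : ℝ)) s := by
    rw [ae_restrict_iff' hUo.measurableSet]
    filter_upwards [ae_lift hp.ae_eq] with s hs hsU
    have hD0 : D (s : Torus) = 0 := by
      have hz : (fun t : ℝ => f (t : Torus)) =ᶠ[𝓝 s] fun _ => 0 :=
        Filter.eventually_of_mem (hUo.mem_nhds hsU) hU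
      exact (hp.hasDerivAt s).unique ((hasDerivAt_const s (0 : ℝ)).congr_of_eventuallyEq hz)
    rw [hs, hD0, hU s hsU]
    simp
  exact Measure.eqOn_open_of_ae_eq h1 hUo hTc.continuousOn continuousOn_const htU

theorem le_sq (hp : IsProfile f D h T) {c r x : ℝ} (hc : 0 < c) (hr : 0 < r)
    (hT : ∀ t ∈ Icc (x - r) (x + r), c ≤ T ((t : ℝ) : Torus)) :
    c * r ^ 2 / 32 ≤ f (x : Torus) ^ 2 :=
  le_sq_of_ode_of_le (F := fun t : ℝ => f (t : Torus)) (D := fun t : ℝ => D (t : Torus))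
    (T := fun t : ℝ => T (t : Torus)) (fun _ => hp.nonneg _) hp.hasDerivAt
    (hp.prim2.continuous.comp continuous_coe_torus) (fun _ => hp.hasDerivAt2)
    (fun _ => hp.T_eq_zero) hc hr hT

theorem continuous_D_sq (hp : IsProfile f D h T) : Continuous fun x => D x ^ 2 :=
  hp.prim2.continuous.pow 2

/-- Testing the identity `T = (3 / 2) f_x² - (f f_x)_x` with `δ / (f + δ)`. This controls the
Dirichlet energy carried by the region where `f` is small. -/
theorem integral_sq_mul_le (hp : IsProfile f D h T) {δ : ℝ} (hδ : 0 < δ) :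
    ∫ x, D x ^ 2 * (δ / (f x + δ)) ≤ 2 * ∫ x, T x * (δ / (f x + δ)) := by
  have hfc := hp.prim.continuous
  have hDc := hp.prim2.continuous
  have hne : ∀ x, f x + δ ≠ 0 := fun x => (add_pos_of_nonneg_of_pos (hp.nonneg x) hδ).ne'
  have hψc : Continuous fun x => δ / (f x + δ) :=
    continuous_const.div (hfc.add continuous_const) hne
  have hψc' : Continuous fun x => -(δ * D x / (f x + δ) ^ 2) :=
    ((continuous_const.mul hDc).div ((hfc.add continuous_const).pow 2)
      fun x => pow_ne_zero 2 (hne x)).neg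
  have hψ : IsPrimitive (fun x => δ / (f x + δ)) (fun x => -(δ * D x / (f x + δ) ^ 2)) := by
    refine isPrimitive_of_hasDerivAt hψc' fun t => ?_
    · have := (hasDerivAt_const t δ).fun_div ((hp.hasDerivAt t).add_const δ) (hne _)
      convert! this using 1
      ring
  have hG := hp.prim.mul hp.prim2
  have h1 := hG.integral_mul_eq_neg hψ
  have hD2 : Integrable fun x => D x ^ 2 * (δ / (f x + δ)) :=
    integrable_of_continuous (hp.continuous_D_sq.mul hψc)
  have hGi := integrable_mul_continuous hG.integrable hψc
  have h2 : ∫ x, T x * (δ / (f x + δ)) = 3 / 2 * (∫ x, D x ^ 2 * (δ / (f x + δ)))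
      - ∫ x, (D x * D x + f x * h x) * (δ / (f x + δ)) := by
    rw [← integral_const_mul, ← integral_sub (hD2.const_mul _) hGi]
    refine integral_congr_ae ?_
    filter_upwards [hp.ae_eq] with x hx
    rw [hx]; ring
  have h3 : ∫ x, -(f x * D x * -(δ * D x / (f x + δ) ^ 2)) ≤ ∫ x, D x ^ 2 * (δ / (f x + δ)) := by
    refine integral_mono (integrable_of_continuous ?_) hD2 fun x => ?_
    · exact ((hfc.mul hDc).mul hψc').neg
    · have hf := hp.nonneg x
      have h4 : f x * (δ / (f x + δ) ^ 2) ≤ δ / (f x + δ) := by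
        rw [mul_div_assoc', div_le_div_iff₀ (by positivity) (by positivity)]
        nlinarith [mul_nonneg hδ.le hδ.le, mul_nonneg (mul_nonneg hδ.le hδ.le)
          (add_nonneg hf hδ.le)]
      calc -(f x * D x * -(δ * D x / (f x + δ) ^ 2))
          = D x ^ 2 * (f x * (δ / (f x + δ) ^ 2)) := by ring
        _ ≤ _ := mul_le_mul_of_nonneg_left h4 (sq_nonneg _)
  rw [integral_neg] at h3
  linarith

theorem integrable_D_sq (hp : IsProfile f D h T) : Integrable fun x => D x ^ 2 :=
  integrable_of_continuous hp.continuous_D_sq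

/-- The flux `f f_x` has derivative bounded in `L¹`. -/
theorem integral_abs_flux_deriv_le (hp : IsProfile f D h T) {B : ℝ} (hB : ∀ x, |T x| ≤ B) :
    ∫ x, |D x * D x + f x * h x| ≤ 3 / 2 * (∫ x, D x ^ 2) + B := by
  have h1 : ∫ x, |D x * D x + f x * h x| ≤ ∫ x, (3 / 2 * D x ^ 2 + B) := by
    refine integral_mono_ae (hp.prim.mul hp.prim2).integrable.abs
      ((hp.integrable_D_sq.const_mul _).add (integrable_const B)) ?_
    filter_upwards [hp.ae_eq] with x hx
    have h2 : D x * D x + f x * h x = 3 / 2 * D x ^ 2 - T x := by rw [hx]; ring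
    simp only [h2]
    calc |3 / 2 * D x ^ 2 - T x| ≤ |3 / 2 * D x ^ 2| + |T x| := abs_sub _ _
      _ ≤ _ := by
        rw [abs_of_nonneg (by positivity)]
        linarith [hB x]
  rw [integral_add (hp.integrable_D_sq.const_mul _) (integrable_const B),
    integral_const_mul] at h1
  simpa using h1

/-- Interpolation: the fluxes `f f_x` of two profiles are close in `L²` if the profiles are
uniformly close. -/
theorem integral_flux_sub_sq_le {f' D' h' T' : Torus → ℝ} (hp : IsProfile f D h T)
    (hp' : IsProfile f' D' h' T') {B η : ℝ} (hB : ∀ x, |T x| ≤ B) (hB' : ∀ x, |T' x| ≤ B)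
    (hη : ∀ x, |f x ^ 2 - f' x ^ 2| ≤ η) :
    ∫ x, (f x * D x - f' x * D' x) ^ 2
      ≤ η / 2 * (3 / 2 * (∫ x, D x ^ 2) + 3 / 2 * (∫ x, D' x ^ 2) + 2 * B) := by
  have hη0 : 0 ≤ η := (abs_nonneg _).trans (hη 0)
  have hG := hp.prim.mul hp.prim2
  have hG' := hp'.prim.mul hp'.prim2
  have hq := ((hp.prim.mul hp.prim).sub (hp'.prim.mul hp'.prim))
  have hs := hG.sub hG'
  have h1 := hq.integral_mul_eq_neg hs
  have h2 : ∫ x, (f x * D x - f' x * D' x) ^ 2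
      = -(1 / 2 * ∫ x, (f x * f x - f' x * f' x)
        * (D x * D x + f x * h x - (D' x * D' x + f' x * h' x))) := by
    rw [h1, mul_neg, neg_neg, ← integral_const_mul]
    refine integral_congr_ae (ae_of_all _ fun x => ?_)
    simp only
    ring
  have h3 : |∫ x, (f x * f x - f' x * f' x)
        * (D x * D x + f x * h x - (D' x * D' x + f' x * h' x))|
      ≤ ∫ x, (η * |D x * D x + f x * h x| + η * |D' x * D' x + f' x * h' x|) := by
    refine abs_integral_le_integral_abs.trans (integral_mono ?_
      ((hG.integrable.abs.const_mul η).add (hG'.integrable.abs.const_mul η)) fun x => ?_)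
    · have := (integrable_mul_continuous hs.integrable hq.continuous).abs
      simpa only [mul_comm] using this
    · simp only [abs_mul]
      rw [← mul_add]
      refine mul_le_mul ?_ (abs_sub _ _) (abs_nonneg _) hη0
      simpa only [sq] using hη x
  rw [integral_add (hG.integrable.abs.const_mul η) (hG'.integrable.abs.const_mul η),
    integral_const_mul, integral_const_mul] at h3
  have h4 := hp.integral_abs_flux_deriv_le hB
  have h5 := hp'.integral_abs_flux_deriv_le hB'
  rw [h2]
  have h6 := neg_le_of_abs_le h3
  nlinarith [mul_le_mul_of_nonneg_left h4 hη0, mul_le_mul_of_nonneg_left h5 hη0]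

end IsProfile

/-! ### Hölder estimates -/

theorem memLp_continuous_mul {f g : Torus → ℝ} (hf : Continuous f) (hg : MemLp g 2) :
    MemLp (fun x => f x * g x) 2 := by
  obtain ⟨B, -, hB⟩ := exists_bound_of_continuous hf
  refine hg.of_le_mul (c := B) (hf.aestronglyMeasurable.mul hg.aestronglyMeasurable)
    (ae_of_all _ fun x => ?_)
  rw [norm_mul]
  exact mul_le_mul_of_nonneg_right (hB x) (norm_nonneg _)

theorem exists_lift_le (x y : Torus) :
    ∃ a b : ℝ, (a : Torus) = x ∧ (b : Torus) = y ∧ a ≤ b ∧ b ≤ a + 1 := by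
  obtain ⟨a, rfl⟩ := QuotientAddGroup.mk_surjective x
  have hy : y ∈ ((↑) : ℝ → Torus) '' Ico a (a + 1) := by
    rw [AddCircle.coe_image_Ico_eq]; trivial
  obtain ⟨b, hb, rfl⟩ := hy
  exact ⟨a, b, rfl, rfl, hb.1, hb.2.le⟩

namespace IsPrimitive

variable {H h : Torus → ℝ}

theorem sq_sub_le (hH : IsPrimitive H h) (h2 : MemLp h 2) {a b : ℝ} (hab : a ≤ b)
    (hb : b ≤ a + 1) : (H (b : Torus) - H (a : Torus)) ^ 2 ≤ (b - a) * ∫ x, h x ^ 2 := by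
  rcases hab.eq_or_lt with rfl | hlt
  · simp
  have hi := intervalIntegrable_lift hH.integrable
  have hi2 := intervalIntegrable_lift h2.integrable_sq
  have hba : 0 < b - a := sub_pos.2 hlt
  -- Cauchy-Schwarz, from the variance of `h` about its average on `[a, b]`
  set m := (H (b : Torus) - H (a : Torus)) / (b - a) with hm
  have h0 : 0 ≤ ∫ t in a..b, (h (t : Torus) - m) ^ 2 :=
    intervalIntegral.integral_nonneg hab fun _ _ => sq_nonneg _
  have h1 : ∫ t in a..b, (h (t : Torus) - m) ^ 2
      = (∫ t in a..b, h (t : Torus) ^ 2) - 2 * m * (H (b : Torus) - H (a : Torus))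
        + (b - a) * m ^ 2 := by
    have he : ∀ t : ℝ, (h (t : Torus) - m) ^ 2
        = h (t : Torus) ^ 2 - 2 * m * h (t : Torus) + m ^ 2 := fun t => by ring
    simp only [he]
    rw [intervalIntegral.integral_add ((hi2 a b).sub ((hi a b).const_mul _))
      intervalIntegrable_const, intervalIntegral.integral_sub (hi2 a b) ((hi a b).const_mul _),
      intervalIntegral.integral_const_mul, hH.integral_eq, intervalIntegral.integral_const,
      smul_eq_mul]
  have h3 : ∫ t in a..b, h (t : Torus) ^ 2 ≤ ∫ x, h x ^ 2 := by
    rw [integral_torus_eq _ a]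
    exact intervalIntegral.integral_mono_interval le_rfl hab hb
      (ae_of_all _ fun _ => sq_nonneg _) (hi2 _ _)
  have h4 : H (b : Torus) - H (a : Torus) = m * (b - a) := by rw [hm]; field_simp
  rw [h1, h4] at h0
  rw [h4]
  nlinarith

theorem abs_sub_le_sqrt (hH : IsPrimitive H h) (h2 : MemLp h 2) (x y : Torus) :
    |H x - H y| ≤ √(∫ z, h z ^ 2) := by
  obtain ⟨a, b, rfl, rfl, hab, hb⟩ := exists_lift_le x y
  have h1 := hH.sq_sub_le h2 hab hb
  have h0 : 0 ≤ ∫ z, h z ^ 2 := integral_nonneg fun _ => sq_nonneg _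
  rw [abs_sub_comm]
  refine Real.abs_le_sqrt (h1.trans ?_)
  nlinarith

theorem abs_sub_integral_le (hH : IsPrimitive H h) (h2 : MemLp h 2) (x : Torus) :
    |H x - ∫ y, H y| ≤ √(∫ z, h z ^ 2) := by
  have hi := integrable_of_continuous hH.continuous
  have h1 : H x - ∫ y, H y = ∫ y, (H x - H y) := by
    rw [integral_sub (integrable_const _) hi]; simp
  rw [h1, ← Real.norm_eq_abs]
  have := norm_integral_le_of_norm_le_const (μ := (volume : Measure Torus))
    (f := fun y => H x - H y) (ae_of_all _ fun y => hH.abs_sub_le_sqrt h2 x y)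
  simpa using this

end IsPrimitive

/-! ### The stress of a profile with finite slope -/

/-- The pressure `P(y) = y W'(y) - W(y)` associated with the potential `W`. -/
def pressure (W : ℝ → ℝ) (y : ℝ) : ℝ :=
  y * potentialDeriv W y - W y

theorem continuousOn_pressure {W : ℝ → ℝ} (hW : ContDiffOn ℝ 2 W (Ici 0)) :
    ContinuousOn (pressure W) (Ici 0) := by
  have h : ContinuousOn (derivWithin W (Ici 0)) (Ici 0) :=
    ContDiffOn.continuousOn_derivWithin hW (uniqueDiffOn_Ici (0 : ℝ)) (by norm_num)
  have h2 : ContinuousOn (fun y => y * derivWithin W (Ici 0) y) (Ici 0) := continuousOn_id.mul h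
  exact h2.sub hW.continuousOn

theorem continuous_pressure_comp {W : ℝ → ℝ} (hW : ContDiffOn ℝ 2 W (Ici 0)) {f : Torus → ℝ}
    (hf : Continuous f) (hf0 : ∀ x, 0 ≤ f x) : Continuous fun x => pressure W (f x) :=
  (continuousOn_pressure hW).comp_continuous hf hf0

/-- The stress depends only on the almost everywhere classes of the density and its weak
derivative. -/
theorem stress_eq {W : ℝ → ℝ} {ε : ℝ} {f' f D : Torus → ℝ} (hf : f' =ᵐ[volume] f)
    (hD : weakDeriv f' =ᵐ[volume] D) (φ : Torus → ℝ) :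
    stress W ε f' φ = (∫ x, (pressure W (f x) + 3 * ε ^ 2 / 2 * D x ^ 2) * φ x)
      + ε ^ 2 * ∫ x, f x * D x * torusDeriv φ x := by
  have e1 : ∫ x, (f' x * potentialDeriv W (f' x) - W (f' x)
      + 3 * ε ^ 2 / 2 * weakDeriv f' x ^ 2) * φ x
      = ∫ x, (pressure W (f x) + 3 * ε ^ 2 / 2 * D x ^ 2) * φ x :=
    integral_congr_ae (by filter_upwards [hf, hD] with x h1 h2 using by rw [h1, h2, pressure])
  have e2 : ∫ x, f' x * weakDeriv f' x * torusDeriv φ x = ∫ x, f x * D x * torusDeriv φ x :=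
    integral_congr_ae (by filter_upwards [hf, hD] with x h1 h2 using by rw [h1, h2])
  rw [stress, e1, e2]

theorem HasWeakDeriv.weakDeriv_ae_eq {f h : Torus → ℝ} (H : HasWeakDeriv f h) :
    weakDeriv f =ᵐ[volume] h :=
  (hasWeakDeriv_weakDeriv H).ae_unique H

theorem isPrimitive_of_continuous {f h : Torus → ℝ} (hf : Continuous f) (H : HasWeakDeriv f h) :
    IsPrimitive f h := by
  obtain ⟨F, hfF, hF⟩ := H.exists_isPrimitive
  have : f = F := (Continuous.ae_eq_iff_eq volume hf hF.continuous).1 hfF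
  rwa [this]

theorem MemH2.exists_isPrimitive {f : Torus → ℝ} (hf : MemH2 f) (hc : Continuous f) :
    ∃ D h, IsPrimitive f D ∧ IsPrimitive D h ∧ weakDeriv f =ᵐ[volume] D := by
  obtain ⟨D, hD, hDh⟩ := hf.2.2.1.exists_isPrimitive
  exact ⟨D, _, (isPrimitive_of_continuous hc hf.1.2.1).congr_ae hD, hDh, hD⟩

/-- The stress of an `H²` profile carrying a slope field `g` is absolutely continuous with
derivative `√f g`. -/
theorem exists_isProfile_of_mem_slopeFields {W : ℝ → ℝ} (hW : ContDiffOn ℝ 2 W (Ici 0)) {ε : ℝ}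
    (hε : 0 < ε) {f f' D h g : Torus → ℝ} (hf0 : ∀ x, 0 ≤ f x) (hf : f' =ᵐ[volume] f)
    (hfD : IsPrimitive f D) (hDh : IsPrimitive D h) (hg : g ∈ slopeFields W ε f') :
    ∃ T S, IsProfile f D h T ∧ IsPrimitive S (fun x => √(f x) * g x) ∧
      MemLp (fun x => √(f x) * g x) 2 ∧ (∀ x, ε ^ 2 * T x = S x - pressure W (f x)) ∧
      ∫ x, S x = (∫ x, pressure W (f x)) + 3 * ε ^ 2 / 2 * ∫ x, D x ^ 2 := by
  have hPc := continuous_pressure_comp hW hfD.continuous hf0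
  have hD2c : Continuous fun x => D x ^ 2 := hDh.continuous.pow 2
  have hsq : Continuous fun x => √(f x) := hfD.continuous.sqrt
  have hs2 : MemLp (fun x => √(f x) * g x) 2 := memLp_continuous_mul hsq hg.1
  have hsi : Integrable fun x => √(f x) * g x := hs2.integrable (by norm_num)
  have hG := hfD.mul hDh
  have hD : weakDeriv f' =ᵐ[volume] D :=
    (hfD.hasWeakDeriv.congr_ae hf.symm (ae_eq_refl D)).weakDeriv_ae_eq
  have hQc : Continuous fun x => pressure W (f x) + 3 * ε ^ 2 / 2 * D x ^ 2 :=
    hPc.add (continuous_const.mul hD2c)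
  set S₀ : Torus → ℝ := fun x => pressure W (f x) + 3 * ε ^ 2 / 2 * D x ^ 2
    - ε ^ 2 * (D x * D x + f x * h x) with hS₀
  have hS₀i : Integrable S₀ :=
    (integrable_of_continuous hQc).sub (hG.integrable.const_mul _)
  have hweak : HasWeakDeriv S₀ (fun x => √(f x) * g x) := by
    refine ⟨hS₀i, hsi, fun φ hφ => ?_⟩
    have h1 := hg.2 φ hφ
    rw [stress_eq hf hD, hG.integral_mul_eq_neg hφ.torusDeriv.isPrimitive] at h1
    have h2 : ∫ x, √(f' x) * g x * φ x = ∫ x, √(f x) * g x * φ x :=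
      integral_congr_ae (hf.mono fun x hx => by simp only [hx])
    rw [← h2, ← h1, neg_neg]
    have h3 : ∀ x, S₀ x * torusDeriv φ x
        = (pressure W (f x) + 3 * ε ^ 2 / 2 * D x ^ 2) * torusDeriv φ x
          - ε ^ 2 * ((D x * D x + f x * h x) * torusDeriv φ x) := fun x => by
      rw [hS₀]; ring
    simp only [h3]
    have h4 : Integrable fun x =>
        (pressure W (f x) + 3 * ε ^ 2 / 2 * D x ^ 2) * torusDeriv φ x :=
      integrable_of_continuous (hQc.mul hφ.torusDeriv.continuous)
    rw [integral_sub h4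
      ((integrable_mul_continuous hG.integrable hφ.torusDeriv.continuous).const_mul _),
      integral_const_mul]
    ring
  obtain ⟨S, hSS, hS⟩ := hweak.exists_isPrimitive
  refine ⟨fun x => (S x - pressure W (f x)) / ε ^ 2, S, ⟨hf0, hfD, hDh,
    (hS.continuous.sub hPc).div_const _, ?_⟩, hS, hs2, fun x => by field_simp, ?_⟩
  · filter_upwards [hSS] with x hx
    rw [← hx, hS₀]
    field_simp
    ring
  · rw [← integral_congr_ae hSS, hS₀, integral_sub (integrable_of_continuous hQc)
      (hG.integrable.const_mul _), integral_const_mul, hG.integral_eq_zero,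
      integral_add (integrable_of_continuous hPc)
      ((integrable_of_continuous hD2c).const_mul _), integral_const_mul]
    ring

/-- A profile whose stress `S` is absolutely continuous with derivative `s ∈ L²`, with all
quantities that enter the compactness argument bounded by `A`. -/
structure IsBoundedProfile (W : ℝ → ℝ) (ε A : ℝ) (f D h T S s : Torus → ℝ) : Prop where
  profile : IsProfile f D h T
  stress : IsPrimitive S s
  memLp : MemLp s 2
  eq : ∀ x, ε ^ 2 * T x = S x - pressure W (f x)
  le : ∀ x, f x ≤ A
  energy_le : ∫ x, D x ^ 2 ≤ A
  slope_le : ∫ x, s x ^ 2 ≤ A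
  abs_le : ∀ x, |T x| ≤ A

/-- Unit mass, finite energy and finite slope bound everything else. -/
theorem exists_isBoundedProfile {W : ℝ → ℝ} (hW : ContDiffOn ℝ 2 W (Ici 0)) {ε : ℝ}
    (hε : 0 < ε) (E : ℝ) : ∃ A : ℝ, ∀ f f' D h g : Torus → ℝ, (∀ x, 0 ≤ f x) →
      f' =ᵐ[volume] f → IsPrimitive f D → IsPrimitive D h → g ∈ slopeFields W ε f' →
      ∫ x, f x = 1 → ∫ x, D x ^ 2 ≤ E → ∫ x, g x ^ 2 ≤ E →
      ∃ T S s, IsBoundedProfile W ε A f D h T S s := by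
  set M : ℝ := 1 + √E with hM
  have hM0 : 0 ≤ M := by positivity
  obtain ⟨B, hB⟩ := (isCompact_Icc (a := (0 : ℝ)) (b := M)).exists_bound_of_continuousOn
    ((continuousOn_pressure hW).mono Icc_subset_Ici_self)
  set N : ℝ := (2 * B + 3 * ε ^ 2 / 2 * E + √(M * E)) / ε ^ 2 with hN
  refine ⟨max (max M E) (max (M * E) N), fun f f' D h g hf0 hf hfD hDh hg h1 hDE hgE => ?_⟩
  obtain ⟨T, S, hp, hS, hs2, hT, hSint⟩ :=
    exists_isProfile_of_mem_slopeFields hW hε hf0 hf hfD hDh hg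
  have hfM : ∀ x, f x ≤ M := fun x => by
    have h2 := hfD.abs_sub_integral_le (memLp_two_of_continuous hDh.continuous) x
    rw [h1] at h2
    have h3 := Real.sqrt_le_sqrt hDE
    have := (le_abs_self _).trans (h2.trans h3)
    rw [hM]; linarith
  have hPB : ∀ x, |pressure W (f x)| ≤ B := fun x => hB _ ⟨hf0 x, hfM x⟩
  have hsE : ∫ x, (√(f x) * g x) ^ 2 ≤ M * E := by
    calc ∫ x, (√(f x) * g x) ^ 2 ≤ ∫ x, M * g x ^ 2 := by
          refine integral_mono hs2.integrable_sq (hg.1.integrable_sq.const_mul M) fun x => ?_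
          simp only [mul_pow, Real.sq_sqrt (hf0 x)]
          exact mul_le_mul_of_nonneg_right (hfM x) (sq_nonneg _)
      _ = M * ∫ x, g x ^ 2 := integral_const_mul _ _
      _ ≤ M * E := mul_le_mul_of_nonneg_left hgE hM0
  have hSI : |∫ x, S x| ≤ B + 3 * ε ^ 2 / 2 * E := by
    have h2 := norm_integral_le_of_norm_le_const (μ := (volume : Measure Torus))
      (f := fun x => pressure W (f x)) (ae_of_all _ hPB)
    have h3 : 0 ≤ ∫ x, D x ^ 2 := integral_nonneg fun _ => sq_nonneg _
    rw [hSint]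
    refine (abs_add_le _ _).trans (add_le_add (by simpa using h2) ?_)
    rw [abs_of_nonneg (by positivity)]
    exact mul_le_mul_of_nonneg_left hDE (by positivity)
  refine ⟨T, S, _, hp, hS, hs2, hT, fun x => (hfM x).trans ((le_max_left _ _).trans
    (le_max_left _ _)), hDE.trans ((le_max_right _ _).trans (le_max_left _ _)),
    hsE.trans ((le_max_left _ _).trans (le_max_right _ _)), fun x =>
    le_trans ?_ ((le_max_right _ _).trans (le_max_right _ _))⟩
  have h2 : |S x - ∫ y, S y| ≤ √(M * E) :=
    (hS.abs_sub_integral_le hs2 x).trans (Real.sqrt_le_sqrt hsE)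
  rw [hN, le_div_iff₀ (by positivity), ← abs_of_pos (show 0 < ε ^ 2 by positivity), ← abs_mul,
    mul_comm, hT x, abs_of_pos (show 0 < ε ^ 2 by positivity)]
  have h3 := hPB x
  rw [abs_le] at *
  constructor <;> linarith [h2.1, h2.2, hSI.1, hSI.2, h3.1, h3.2]

/-! ### Strong compactness of the derivatives -/

/-- Where a bounded profile is small, `T` cannot be large, uniformly in the profile. -/
theorem exists_threshold {W : ℝ → ℝ} (hW : ContDiffOn ℝ 2 W (Ici 0)) {ε : ℝ} (hε : 0 < ε)
    (A : ℝ) {c : ℝ} (hc : 0 < c) : ∃ κ > 0, ∀ f D h T S s : Torus → ℝ,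
      IsBoundedProfile W ε A f D h T S s → ∀ x, f x < κ → T x ≤ c := by
  have huc : UniformContinuousOn (pressure W) (Icc 0 A) :=
    isCompact_Icc.uniformContinuousOn_of_continuous
      ((continuousOn_pressure hW).mono Icc_subset_Ici_self)
  set c' : ℝ := ε ^ 2 * c / 4 with hc'
  have hc'0 : 0 < c' := by positivity
  obtain ⟨τ, hτ, hmod⟩ := Metric.uniformContinuousOn_iff.1 huc c' hc'0
  set e : ℝ := min (c' ^ 2) (τ ^ 2 / 4) with he
  have he0 : 0 < e := by positivity
  -- within distance `r` a bounded profile varies by less than `τ` and its stress by at most `c'`,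
  -- so that `ε² T` varies by at most `2 c' = ε² c / 2`
  set r : ℝ := min 1 (e / (|A| + 1)) with hr
  have hr0 : 0 < r := by positivity
  have hrA : r * |A| ≤ e := by
    have h1 : r ≤ e / (|A| + 1) := min_le_right _ _
    have h2 : e / (|A| + 1) * (|A| + 1) = e := by field_simp
    nlinarith [abs_nonneg A]
  refine ⟨√(c / 2 * r ^ 2 / 32), by positivity, fun f D h T S s hb x hx => ?_⟩
  obtain ⟨t₀, rfl⟩ := QuotientAddGroup.mk_surjective x
  by_contra! hTc
  have hosc : ∀ H k : Torus → ℝ, IsPrimitive H k → MemLp k 2 → ∫ x, k x ^ 2 ≤ A →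
      ∀ t ∈ Icc (t₀ - r) (t₀ + r), (H (t : Torus) - H (t₀ : Torus)) ^ 2 ≤ e := by
    intro H k hHk hk hkA t ht
    have hk0 : 0 ≤ ∫ x, k x ^ 2 := integral_nonneg fun _ => sq_nonneg _
    have hkA' : ∫ x, k x ^ 2 ≤ |A| := hkA.trans (le_abs_self A)
    have hr1 : r ≤ 1 := min_le_left _ _
    rcases le_total t t₀ with h | h
    · have := hHk.sq_sub_le hk h (by linarith [ht.1])
      have h5 : (t₀ - t) * ∫ x, k x ^ 2 ≤ r * |A| :=
        mul_le_mul (by linarith [ht.1]) hkA' hk0 hr0.le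
      nlinarith
    · have := hHk.sq_sub_le hk h (by linarith [ht.2])
      have h5 : (t - t₀) * ∫ x, k x ^ 2 ≤ r * |A| :=
        mul_le_mul (by linarith [ht.2]) hkA' hk0 hr0.le
      linarith
  have hTlow : ∀ t ∈ Icc (t₀ - r) (t₀ + r), c / 2 ≤ T ((t : ℝ) : Torus) := by
    intro t ht
    have h1 := hosc S s hb.stress hb.memLp hb.slope_le t ht
    have h2 := hosc f D hb.profile.prim (memLp_two_of_continuous hb.profile.prim2.continuous)
      hb.energy_le t ht
    have h3 : |S (t : Torus) - S (t₀ : Torus)| ≤ c' :=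
      abs_le_of_sq_le_sq (h1.trans (min_le_left _ _)) hc'0.le
    have h4 : |f (t : Torus) - f (t₀ : Torus)| ≤ τ / 2 :=
      abs_le_of_sq_le_sq (h2.trans ((min_le_right _ _).trans (by ring_nf; rfl))) (by positivity)
    have h5 := hmod _ ⟨hb.profile.nonneg t, hb.le t⟩ _ ⟨hb.profile.nonneg t₀, hb.le t₀⟩
      (by rw [Real.dist_eq]; linarith)
    rw [Real.dist_eq] at h5
    have h6 := hb.eq t
    have h7 : ε ^ 2 * T (t₀ : Torus) = S (t₀ : Torus) - pressure W (f (t₀ : Torus)) := hb.eq t₀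
    have h8 : ε ^ 2 * c < ε ^ 2 * T (t₀ : Torus) :=
      mul_lt_mul_of_pos_left hTc (by positivity)
    rw [abs_le] at h3
    rw [abs_lt] at h5
    have h9 : ε ^ 2 * (c / 2) ≤ ε ^ 2 * T (t : Torus) := by
      rw [h6]; linarith [h3.1, h5.2]
    exact le_of_mul_le_mul_left h9 (by positivity)
  have h1 := hb.profile.le_sq (half_pos hc) hr0 hTlow
  have h2 : √(c / 2 * r ^ 2 / 32) ≤ f (t₀ : Torus) := by
    rw [← Real.sqrt_sq (hb.profile.nonneg (t₀ : Torus))]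
    exact Real.sqrt_le_sqrt h1
  exact absurd hx (not_lt.2 h2)

/-- The Dirichlet energy near the zero set is small, uniformly over bounded profiles. -/
theorem exists_energy_le {W : ℝ → ℝ} (hW : ContDiffOn ℝ 2 W (Ici 0)) {ε : ℝ} (hε : 0 < ε)
    (A : ℝ) {η : ℝ} (hη : 0 < η) : ∃ δ > 0, ∀ f D h T S s : Torus → ℝ,
      IsBoundedProfile W ε A f D h T S s → ∫ x, D x ^ 2 * (δ / (f x + δ)) ≤ η := by
  obtain ⟨κ, hκ, hthr⟩ := exists_threshold hW hε A (c := η / 4) (by positivity)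
  set δ : ℝ := κ * η / (4 * (|A| + 1)) with hδ
  have hδ0 : 0 < δ := by positivity
  have hδA : |A| * δ ≤ η / 4 * κ := by
    have h1 : δ * (|A| + 1) = η / 4 * κ := by rw [hδ]; field_simp
    nlinarith
  refine ⟨δ, hδ0, fun f D h T S s hb => ?_⟩
  have hf := hb.profile.nonneg
  have hψc : Continuous fun x => δ / (f x + δ) :=
    continuous_const.div (hb.profile.prim.continuous.add continuous_const)
      fun x => (add_pos_of_nonneg_of_pos (hf x) hδ0).ne'
  have h1 : ∫ x, T x * (δ / (f x + δ)) ≤ ∫ _ : Torus, η / 2 := by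
    refine integral_mono (integrable_of_continuous (hb.profile.cont.mul hψc))
      (integrable_const _) fun x => ?_
    show T x * (δ / (f x + δ)) ≤ η / 2
    have hpos : 0 < f x + δ := add_pos_of_nonneg_of_pos (hf x) hδ0
    have hψ0 : 0 ≤ δ / (f x + δ) := by positivity
    rcases lt_or_ge (f x) κ with hx | hx
    · have hψ1 : δ / (f x + δ) ≤ 1 := (div_le_one hpos).2 (by linarith [hf x])
      have h2 := mul_le_mul_of_nonneg_right (hthr f D h T S s hb x hx) hψ0
      nlinarith
    · have h2 : T x ≤ |A| := (le_abs_self _).trans ((hb.abs_le x).trans (le_abs_self A))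
      have h3 : |A| * (δ / (f x + δ)) ≤ η / 4 := by
        rw [mul_div_assoc', div_le_iff₀ hpos]
        nlinarith
      have h4 := mul_le_mul_of_nonneg_right h2 hψ0
      linarith
  have h2 := hb.profile.integral_sq_mul_le hδ0
  simp only [integral_const, probReal_univ, one_smul] at h1
  linarith

/-- Uniformly close bounded profiles have derivatives close in `L²`. Where the profiles are not
small, the derivative is the flux divided by the profile; elsewhere the energy is small. -/
theorem exists_energy_sub_le {W : ℝ → ℝ} (hW : ContDiffOn ℝ 2 W (Ici 0)) {ε : ℝ} (hε : 0 < ε)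
    (A : ℝ) {η : ℝ} (hη : 0 < η) : ∃ θ > 0, ∀ f D h T S s f' D' h' T' S' s' : Torus → ℝ,
      IsBoundedProfile W ε A f D h T S s → IsBoundedProfile W ε A f' D' h' T' S' s' →
      (∀ x, |f x - f' x| ≤ θ) → ∫ x, (D x - D' x) ^ 2 ≤ η := by
  obtain ⟨δ, hδ, hen⟩ := exists_energy_le hW hε A (η := η / 20) (by positivity)
  -- `R θ / δ²` dominates the contribution of the region where `f ≥ δ`
  set R : ℝ := 10 * A ^ 2 + 2 * |A| + 1 with hR
  have hR0 : 0 < R := by positivity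
  set θ : ℝ := min (min δ 1) (η * δ ^ 2 / (2 * R)) with hθ
  have hθ0 : 0 < θ := by positivity
  have hθδ : θ ≤ δ := (min_le_left _ _).trans (min_le_left _ _)
  have hθ1 : θ ≤ 1 := (min_le_left _ _).trans (min_le_right _ _)
  have hθR : R * θ / δ ^ 2 ≤ η / 2 := by
    have h1 : θ ≤ η * δ ^ 2 / (2 * R) := min_le_right _ _
    rw [le_div_iff₀ (by positivity)] at h1
    rw [div_le_iff₀ (by positivity)]
    linarith
  refine ⟨θ, hθ0, fun f D h T S s f' D' h' T' S' s' hb hb' hclose => ?_⟩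
  have hf := hb.profile.nonneg
  have hf' := hb'.profile.nonneg
  have hA : 0 ≤ A := (hf 0).trans (hb.le 0)
  have hfc := hb.profile.prim.continuous
  have hfc' := hb'.profile.prim.continuous
  have hDc := hb.profile.prim2.continuous
  have hDc' := hb'.profile.prim2.continuous
  have hflux := hb.profile.integral_flux_sub_sq_le hb'.profile hb.abs_le hb'.abs_le
    (η := 2 * A * θ) fun x => by
      rw [sq_sub_sq, abs_mul, abs_of_nonneg (add_nonneg (hf x) (hf' x))]
      exact mul_le_mul (by linarith [hb.le x, hb'.le x]) (hclose x) (abs_nonneg _)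
        (by linarith)
  have hflux2 : ∫ x, (f x * D x - f' x * D' x) ^ 2 ≤ 5 * A ^ 2 * θ := by
    refine hflux.trans ?_
    nlinarith [mul_nonneg hA hθ0.le, hb.energy_le, hb'.energy_le]
  have hψc : Continuous fun x => D x ^ 2 * (δ / (f x + δ)) :=
    (hDc.pow 2).mul (continuous_const.div (hfc.add continuous_const)
      fun x => (add_pos_of_nonneg_of_pos (hf x) hδ).ne')
  have hψc' : Continuous fun x => D' x ^ 2 * (δ / (f' x + δ)) :=
    (hDc'.pow 2).mul (continuous_const.div (hfc'.add continuous_const)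
      fun x => (add_pos_of_nonneg_of_pos (hf' x) hδ).ne')
  have hi1 : Integrable fun x => 2 / δ ^ 2 * (f x * D x - f' x * D' x) ^ 2 :=
    integrable_of_continuous (by fun_prop)
  have hi2 : Integrable fun x => 2 * θ ^ 2 / δ ^ 2 * D' x ^ 2 :=
    integrable_of_continuous (by fun_prop)
  have hi3 : Integrable fun x => 4 * (D x ^ 2 * (δ / (f x + δ))) :=
    integrable_of_continuous (continuous_const.mul hψc)
  have hi4 : Integrable fun x => 6 * (D' x ^ 2 * (δ / (f' x + δ))) :=
    integrable_of_continuous (continuous_const.mul hψc')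
  have hi12 : Integrable fun x => 2 / δ ^ 2 * (f x * D x - f' x * D' x) ^ 2
      + 2 * θ ^ 2 / δ ^ 2 * D' x ^ 2 := hi1.add hi2
  have hi123 : Integrable fun x => 2 / δ ^ 2 * (f x * D x - f' x * D' x) ^ 2
      + 2 * θ ^ 2 / δ ^ 2 * D' x ^ 2 + 4 * (D x ^ 2 * (δ / (f x + δ))) := hi12.add hi3
  have hmono : ∫ x, (D x - D' x) ^ 2 ≤ ∫ x, (2 / δ ^ 2 * (f x * D x - f' x * D' x) ^ 2
      + 2 * θ ^ 2 / δ ^ 2 * D' x ^ 2 + 4 * (D x ^ 2 * (δ / (f x + δ)))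
      + 6 * (D' x ^ 2 * (δ / (f' x + δ)))) := by
    refine integral_mono (integrable_of_continuous (by fun_prop))
      (hi123.add hi4) fun x => ?_
    have hp : 0 < f x + δ := add_pos_of_nonneg_of_pos (hf x) hδ
    have hp' : 0 < f' x + δ := add_pos_of_nonneg_of_pos (hf' x) hδ
    have hcx := abs_le.1 (hclose x)
    have n1 : 0 ≤ 2 / δ ^ 2 * (f x * D x - f' x * D' x) ^ 2 := by positivity
    have n2 : 0 ≤ 2 * θ ^ 2 / δ ^ 2 * D' x ^ 2 := by positivity
    have n3 : 0 ≤ D x ^ 2 * (δ / (f x + δ)) := by positivity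
    have n4 : 0 ≤ D' x ^ 2 * (δ / (f' x + δ)) := by positivity
    show (D x - D' x) ^ 2 ≤ 2 / δ ^ 2 * (f x * D x - f' x * D' x) ^ 2
      + 2 * θ ^ 2 / δ ^ 2 * D' x ^ 2 + 4 * (D x ^ 2 * (δ / (f x + δ)))
      + 6 * (D' x ^ 2 * (δ / (f' x + δ)))
    rcases lt_or_ge (f x) δ with hx | hx
    -- here `f < δ` and `f' < 2 δ`, so the weights are at least `1 / 2` and `1 / 3`
    · have e1 : 1 / 2 ≤ δ / (f x + δ) := by
        rw [div_le_div_iff₀ two_pos hp]; linarith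
      have e2 : 1 / 3 ≤ δ / (f' x + δ) := by
        rw [div_le_div_iff₀ three_pos hp']; linarith
      have e3 := mul_le_mul_of_nonneg_left e1 (sq_nonneg (D x))
      have e4 := mul_le_mul_of_nonneg_left e2 (sq_nonneg (D' x))
      nlinarith [sq_nonneg (D x + D' x)]
    · set G := f x * D x - f' x * D' x with hG
      have e1 : f x * (D x - D' x) = G - (f x - f' x) * D' x := by rw [hG]; ring
      have e2 : δ ^ 2 * (D x - D' x) ^ 2 ≤ 2 * G ^ 2 + 2 * θ ^ 2 * D' x ^ 2 := by
        have e3 : δ ^ 2 * (D x - D' x) ^ 2 ≤ (f x * (D x - D' x)) ^ 2 := by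
          rw [mul_pow]
          exact mul_le_mul_of_nonneg_right (pow_le_pow_left₀ hδ.le hx 2) (sq_nonneg _)
        have e4 : ((f x - f' x) * D' x) ^ 2 ≤ θ ^ 2 * D' x ^ 2 := by
          rw [mul_pow]
          exact mul_le_mul_of_nonneg_right (sq_le_sq' hcx.1 hcx.2) (sq_nonneg _)
        rw [e1] at e3
        nlinarith [sq_nonneg (G + (f x - f' x) * D' x)]
      have e5 : (D x - D' x) ^ 2 ≤ 2 / δ ^ 2 * G ^ 2 + 2 * θ ^ 2 / δ ^ 2 * D' x ^ 2 := by
        have e6 : 2 / δ ^ 2 * G ^ 2 + 2 * θ ^ 2 / δ ^ 2 * D' x ^ 2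
            = (2 * G ^ 2 + 2 * θ ^ 2 * D' x ^ 2) / δ ^ 2 := by ring
        rw [e6, le_div_iff₀ (by positivity)]
        linarith
      linarith
  rw [integral_add hi123 hi4, integral_add hi12 hi3,
    integral_add hi1 hi2, integral_const_mul, integral_const_mul, integral_const_mul,
    integral_const_mul] at hmono
  have b1 : 2 / δ ^ 2 * ∫ x, (f x * D x - f' x * D' x) ^ 2 ≤ 2 / δ ^ 2 * (5 * A ^ 2 * θ) :=
    mul_le_mul_of_nonneg_left hflux2 (by positivity)
  have b2 : 2 * θ ^ 2 / δ ^ 2 * ∫ x, D' x ^ 2 ≤ 2 * θ / δ ^ 2 * |A| := by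
    refine mul_le_mul ?_ (hb'.energy_le.trans (le_abs_self A))
      (integral_nonneg fun _ => sq_nonneg _) (by positivity)
    gcongr
    nlinarith
  have b3 : 2 / δ ^ 2 * (5 * A ^ 2 * θ) + 2 * θ / δ ^ 2 * |A| ≤ η / 2 := by
    refine le_trans ?_ hθR
    have : 2 / δ ^ 2 * (5 * A ^ 2 * θ) + 2 * θ / δ ^ 2 * |A|
        = (10 * A ^ 2 + 2 * |A|) * θ / δ ^ 2 := by ring
    rw [this]
    gcongr
    rw [hR]; linarith
  have b4 := hen f D h T S s hb
  have b5 := hen f' D' h' T' S' s' hb'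
  linarith

/-! ### Convergence in `L²` -/

theorem eLpNorm_two_eq {f : Torus → ℝ} (hf : MemLp f 2) :
    eLpNorm f 2 = ENNReal.ofReal (√(∫ x, f x ^ 2)) := by
  rw [hf.eLpNorm_eq_integral_rpow_norm two_ne_zero ENNReal.ofNat_ne_top, Real.sqrt_eq_rpow]
  simp

theorem integral_sq_le_of_eLpNorm_le {f : Torus → ℝ} (hf : MemLp f 2) {K : ℝ} (hK : 0 ≤ K)
    (h : eLpNorm f 2 ≤ ENNReal.ofReal K) : ∫ x, f x ^ 2 ≤ K ^ 2 := by
  rw [eLpNorm_two_eq hf, ENNReal.ofReal_le_ofReal_iff hK] at h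
  exact (Real.sqrt_le_left hK).1 h

theorem inner_toLp {u v : Torus → ℝ} (hu : MemLp u 2) (hv : MemLp v 2) :
    inner ℝ (hu.toLp u) (hv.toLp v) = ∫ x, u x * v x := by
  rw [L2.inner_def]
  refine integral_congr_ae ?_
  filter_upwards [hu.coeFn_toLp, hv.coeFn_toLp] with x h1 h2
  rw [h1, h2, real_inner_eq_re_inner, RCLike.inner_apply]
  simp [mul_comm]

theorem norm_toLp_eq {u : Torus → ℝ} (hu : MemLp u 2) : ‖hu.toLp u‖ = √(∫ x, u x ^ 2) := by
  rw [Lp.norm_toLp, eLpNorm_two_eq hu, ENNReal.toReal_ofReal (Real.sqrt_nonneg _)]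

theorem abs_integral_mul_le {u v : Torus → ℝ} (hu : MemLp u 2) (hv : MemLp v 2) :
    |∫ x, u x * v x| ≤ √(∫ x, u x ^ 2) * √(∫ x, v x ^ 2) := by
  rw [← inner_toLp hu hv, ← norm_toLp_eq hu, ← norm_toLp_eq hv]
  exact abs_real_inner_le_norm _ _

theorem tendsto_integral_mul {u v : ℕ → Torus → ℝ} {u₀ v₀ : Torus → ℝ} (hu : ∀ n, MemLp (u n) 2)
    (hv : ∀ n, MemLp (v n) 2) (hu₀ : MemLp u₀ 2) (hv₀ : MemLp v₀ 2)
    (hul : Tendsto (fun n => eLpNorm (u n - u₀) 2) atTop (𝓝 0))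
    (hvl : Tendsto (fun n => eLpNorm (v n - v₀) 2) atTop (𝓝 0)) :
    Tendsto (fun n => ∫ x, u n x * v n x) atTop (𝓝 (∫ x, u₀ x * v₀ x)) := by
  have h := ((Lp.tendsto_Lp_iff_tendsto_eLpNorm'' u hu u₀ hu₀).2 hul).inner (𝕜 := ℝ)
    ((Lp.tendsto_Lp_iff_tendsto_eLpNorm'' v hv v₀ hv₀).2 hvl)
  simpa only [inner_toLp] using h

theorem tendsto_eLpNorm_mul_continuous {u : ℕ → Torus → ℝ} {u₀ χ : Torus → ℝ}
    (hχ : Continuous χ) (hul : Tendsto (fun n => eLpNorm (u n - u₀) 2) atTop (𝓝 0)) :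
    Tendsto (fun n => eLpNorm ((fun x => u n x * χ x) - fun x => u₀ x * χ x) 2) atTop (𝓝 0) := by
  obtain ⟨B, -, hB⟩ := exists_bound_of_continuous hχ
  have h1 : Tendsto (fun n => ENNReal.ofReal B * eLpNorm (u n - u₀) 2) atTop (𝓝 0) := by
    simpa using ENNReal.Tendsto.const_mul hul (Or.inr ENNReal.ofReal_ne_top)
  refine tendsto_of_tendsto_of_tendsto_of_le_of_le tendsto_const_nhds h1
    (fun _ => zero_le) fun n => ?_
  refine eLpNorm_le_mul_eLpNorm_of_ae_le_mul (ae_of_all _ fun x => ?_) 2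
  simp only [Pi.sub_apply, ← sub_mul, norm_mul]
  rw [mul_comm]
  exact mul_le_mul_of_nonneg_right (hB x) (norm_nonneg _)

theorem tendsto_eLpNorm_of_tendstoUniformly {u : ℕ → Torus → ℝ} {u₀ : Torus → ℝ}
    (h : TendstoUniformly u u₀ atTop) :
    Tendsto (fun n => eLpNorm (u n - u₀) 2) atTop (𝓝 0) := by
  refine ENNReal.tendsto_nhds_zero.2 fun η hη => ?_
  rcases eq_or_ne η ⊤ with rfl | hη'
  · exact Eventually.of_forall fun _ => le_top
  have hpos : 0 < η.toReal := ENNReal.toReal_pos hη.ne' hη'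
  filter_upwards [Metric.tendstoUniformly_iff.1 h η.toReal hpos] with n hn
  have h1 := eLpNorm_le_of_ae_bound (p := 2) (μ := (volume : Measure Torus)) (f := u n - u₀)
    (C := η.toReal) (ae_of_all _ fun x => by
      have := hn x
      rw [dist_comm, dist_eq_norm] at this
      exact this.le)
  simpa [ENNReal.ofReal_toReal hη'] using h1

theorem exists_tendsto_of_cauchy {u : ℕ → Torus → ℝ} (hu : ∀ n, MemLp (u n) 2)
    (hc : ∀ η > 0, ∃ N, ∀ m ≥ N, ∀ n ≥ N, ∫ x, (u m x - u n x) ^ 2 ≤ η) :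
    ∃ u₀, MemLp u₀ 2 ∧ Tendsto (fun n => eLpNorm (u n - u₀) 2) atTop (𝓝 0) := by
  have hcs : CauchySeq fun n => (hu n).toLp (u n) := by
    refine Metric.cauchySeq_iff.2 fun η hη => ?_
    obtain ⟨N, hN⟩ := hc ((η / 2) ^ 2) (by positivity)
    refine ⟨N, fun m hm n hn => ?_⟩
    rw [dist_eq_norm, ← MemLp.toLp_sub, norm_toLp_eq]
    have h1 : √(∫ x, (u m - u n) x ^ 2) ≤ η / 2 := by
      rw [Real.sqrt_le_left (by positivity)]
      exact hN m hm n hn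
    linarith
  obtain ⟨v, hv⟩ := cauchySeq_tendsto_of_complete hcs
  refine ⟨v, Lp.memLp v, ?_⟩
  rw [← Lp.tendsto_Lp_iff_tendsto_eLpNorm'' u hu v (Lp.memLp v)]
  simpa using hv

/-! ### Compactness of bounded profiles -/

theorem exists_lift_abs_eq_dist (x y : Torus) :
    ∃ a b : ℝ, (a : Torus) = x ∧ (b : Torus) = y ∧ |b - a| = dist x y := by
  obtain ⟨a, rfl⟩ := QuotientAddGroup.mk_surjective x
  obtain ⟨b, rfl⟩ := QuotientAddGroup.mk_surjective y
  refine ⟨a, b - round (b - a), rfl, ?_, ?_⟩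
  · have h1 : ((round (b - a) : ℝ) : Torus) = 0 :=
      (AddCircle.coe_eq_zero_iff 1).2 ⟨round (b - a), by simp⟩
    rw [AddCircle.coe_sub, h1, sub_zero]
  · rw [dist_comm, dist_eq_norm]
    have h1 : ‖((b - a : ℝ) : Torus)‖ = |b - a - round (b - a)| := UnitAddCircle.norm_eq
    rw [AddCircle.coe_sub] at h1
    rw [h1]
    congr 1
    ring

theorem IsPrimitive.sq_sub_le_dist {H h : Torus → ℝ} (hH : IsPrimitive H h) (h2 : MemLp h 2)
    (x y : Torus) : (H x - H y) ^ 2 ≤ dist x y * ∫ z, h z ^ 2 := by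
  obtain ⟨a, b, rfl, rfl, hab⟩ := exists_lift_abs_eq_dist x y
  have hle : |b - a| ≤ 1 := by
    rw [hab, dist_eq_norm]
    refine (AddCircle.norm_le_half_period 1 one_ne_zero).trans ?_
    norm_num
  rw [← hab]
  rcases le_total a b with h | h
  · rw [abs_of_nonneg (sub_nonneg.2 h)] at hle ⊢
    have := hH.sq_sub_le h2 h (by linarith)
    nlinarith
  · rw [abs_of_nonpos (sub_nonpos.2 h)] at hle ⊢
    have := hH.sq_sub_le h2 h (by linarith)
    linarith

/-- Bounded profiles are precompact: along a subsequence they converge uniformly, and their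
derivatives converge strongly in `L²`. -/
theorem exists_subseq_tendsto {W : ℝ → ℝ} (hW : ContDiffOn ℝ 2 W (Ici 0)) {ε : ℝ} (hε : 0 < ε)
    {A : ℝ} {f D h T S s : ℕ → Torus → ℝ}
    (hb : ∀ n, IsBoundedProfile W ε A (f n) (D n) (h n) (T n) (S n) (s n)) :
    ∃ (θ : ℕ → ℕ) (f₀ D₀ : Torus → ℝ), StrictMono θ ∧ Continuous f₀ ∧ (∀ x, 0 ≤ f₀ x) ∧
      MemLp D₀ 2 ∧ HasWeakDeriv f₀ D₀ ∧ TendstoUniformly (fun n => f (θ n)) f₀ atTop ∧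
      Tendsto (fun n => eLpNorm (D (θ n) - D₀) 2) atTop (𝓝 0) := by
  have hfc : ∀ n, Continuous (f n) := fun n => (hb n).profile.prim.continuous
  have hDL : ∀ n, MemLp (D n) 2 := fun n =>
    memLp_two_of_continuous (hb n).profile.prim2.continuous
  have hA : 0 ≤ A := ((hb 0).profile.nonneg 0).trans ((hb 0).le 0)
  set F : ℕ → BoundedContinuousFunction Torus ℝ := fun n =>
    BoundedContinuousFunction.mkOfCompact ⟨f n, hfc n⟩ with hF
  have hequi : Equicontinuous ((↑) : range F → Torus → ℝ) := by
    refine Metric.equicontinuous_of_continuity_modulus (fun r => √(r * A)) ?_ _ ?_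
    · have : Continuous fun r : ℝ => √(r * A) := by fun_prop
      simpa using this.tendsto 0
    · rintro x y ⟨-, n, rfl⟩
      rw [Real.dist_eq]
      refine Real.abs_le_sqrt (((hb n).profile.prim.sq_sub_le_dist (hDL n) x y).trans ?_)
      exact mul_le_mul_of_nonneg_left (hb n).energy_le dist_nonneg
  have hcomp : IsCompact (closure (range F)) := by
    refine BoundedContinuousFunction.arzela_ascoli (Icc 0 A) isCompact_Icc _ ?_ hequi
    rintro - x ⟨n, rfl⟩
    exact ⟨(hb n).profile.nonneg x, (hb n).le x⟩
  obtain ⟨f₀, -, θ, hθ, hlim⟩ := hcomp.tendsto_subseq fun n => subset_closure (mem_range_self n)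
  have hunif : TendstoUniformly (fun n => f (θ n)) f₀ atTop :=
    BoundedContinuousFunction.tendsto_iff_tendstoUniformly.1 hlim
  have hcauchy : ∀ η > 0, ∃ N, ∀ m ≥ N, ∀ n ≥ N, ∫ x, (D (θ m) x - D (θ n) x) ^ 2 ≤ η := by
    intro η hη
    obtain ⟨κ, hκ, hclose⟩ := exists_energy_sub_le hW hε A hη
    obtain ⟨N, hN⟩ := eventually_atTop.1
      (Metric.tendstoUniformly_iff.1 hunif (κ / 2) (by positivity))
    refine ⟨N, fun m hm n hn => hclose _ _ _ _ _ _ _ _ _ _ _ _ (hb _) (hb _) fun x => ?_⟩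
    have h1 := hN m hm x
    have h2 := hN n hn x
    rw [← Real.dist_eq]
    linarith [dist_triangle_left (f (θ m) x) (f (θ n) x) (f₀ x)]
  obtain ⟨D₀, hD₀, hDlim⟩ := exists_tendsto_of_cauchy (fun n => hDL (θ n)) hcauchy
  have hpt : ∀ x, Tendsto (fun n => f (θ n) x) atTop (𝓝 (f₀ x)) := fun x => hunif.tendsto_at x
  refine ⟨θ, f₀, D₀, hθ, f₀.continuous, fun x => ge_of_tendsto' (hpt x)
    fun n => (hb _).profile.nonneg x, hD₀, ⟨integrable_of_continuous f₀.continuous,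
    hD₀.integrable (by norm_num), fun φ hφ => ?_⟩, hunif, hDlim⟩
  have hconst : ∀ φ : Torus → ℝ, Tendsto (fun _ : ℕ => eLpNorm (φ - φ) 2) atTop (𝓝 0) := by
    intro φ; simp
  have hφL := memLp_two_of_continuous hφ.continuous
  have hφL' := memLp_two_of_continuous hφ.torusDeriv.continuous
  have h1 := tendsto_integral_mul (fun n => memLp_two_of_continuous (hfc (θ n)))
    (fun _ => hφL') (memLp_two_of_continuous f₀.continuous) hφL'
    (tendsto_eLpNorm_of_tendstoUniformly hunif) (hconst _)
  have h2 := (tendsto_integral_mul (fun n => hDL (θ n)) (fun _ => hφL) hD₀ hφL hDlim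
    (hconst _)).neg
  refine tendsto_nhds_unique h1 (h2.congr fun n => ?_)
  exact ((hb (θ n)).profile.prim.integral_mul_eq_neg hφ.isPrimitive).symm

/-- Strong convergence of the derivatives passes to the limit in the stress. -/
theorem tendsto_stress {W : ℝ → ℝ} (hW : ContDiffOn ℝ 2 W (Ici 0)) (ε : ℝ) {A : ℝ}
    {f D : ℕ → Torus → ℝ} {f₀ D₀ : Torus → ℝ} (hfc : ∀ n, Continuous (f n))
    (hf0 : ∀ n x, 0 ≤ f n x) (hfA : ∀ n x, f n x ≤ A) (hf₀c : Continuous f₀)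
    (hDL : ∀ n, MemLp (D n) 2) (hD₀ : MemLp D₀ 2) (hunif : TendstoUniformly f f₀ atTop)
    (hDlim : Tendsto (fun n => eLpNorm (D n - D₀) 2) atTop (𝓝 0))
    {χ χ' : Torus → ℝ} (hχ : Continuous χ) (hχ' : Continuous χ') :
    Tendsto (fun n => (∫ x, (pressure W (f n x) + 3 * ε ^ 2 / 2 * D n x ^ 2) * χ x)
      + ε ^ 2 * ∫ x, f n x * D n x * χ' x) atTop
      (𝓝 ((∫ x, (pressure W (f₀ x) + 3 * ε ^ 2 / 2 * D₀ x ^ 2) * χ x)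
        + ε ^ 2 * ∫ x, f₀ x * D₀ x * χ' x)) := by
  have hpt : ∀ x, Tendsto (fun n => f n x) atTop (𝓝 (f₀ x)) := fun x => hunif.tendsto_at x
  have hf₀0 : ∀ x, 0 ≤ f₀ x := fun x => ge_of_tendsto' (hpt x) fun n => hf0 n x
  have hf₀A : ∀ x, f₀ x ≤ A := fun x => le_of_tendsto' (hpt x) fun n => hfA n x
  have hPc := fun n => continuous_pressure_comp hW (hfc n) (hf0 n)
  have hP₀c := continuous_pressure_comp hW hf₀c hf₀0
  have huc : UniformContinuousOn (pressure W) (Icc 0 A) :=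
    isCompact_Icc.uniformContinuousOn_of_continuous
      ((continuousOn_pressure hW).mono Icc_subset_Ici_self)
  have hPunif : TendstoUniformly (fun n x => pressure W (f n x))
      (fun x => pressure W (f₀ x)) atTop := by
    refine Metric.tendstoUniformly_iff.2 fun η hη => ?_
    obtain ⟨τ, hτ, hmod⟩ := Metric.uniformContinuousOn_iff.1 huc η hη
    filter_upwards [Metric.tendstoUniformly_iff.1 hunif τ hτ] with n hn x
    exact hmod _ ⟨hf₀0 x, hf₀A x⟩ _ ⟨hf0 n x, hfA n x⟩ (hn x)
  have hconst : ∀ φ : Torus → ℝ, Tendsto (fun _ : ℕ => eLpNorm (φ - φ) 2) atTop (𝓝 0) := by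
    intro φ; simp
  have hmulL : ∀ {u χ : Torus → ℝ}, MemLp u 2 → Continuous χ → MemLp (fun x => u x * χ x) 2 :=
    fun hu hχ => by simpa only [mul_comm] using memLp_continuous_mul hχ hu
  have t1 := tendsto_integral_mul (fun n => memLp_two_of_continuous (hPc n))
    (fun _ => memLp_two_of_continuous hχ) (memLp_two_of_continuous hP₀c)
    (memLp_two_of_continuous hχ) (tendsto_eLpNorm_of_tendstoUniformly hPunif) (hconst _)
  have t2 := tendsto_integral_mul hDL (fun n => hmulL (hDL n) hχ) hD₀ (hmulL hD₀ hχ) hDlim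
    (tendsto_eLpNorm_mul_continuous hχ hDlim)
  have t3 := tendsto_integral_mul (fun n => memLp_two_of_continuous (hfc n))
    (fun n => hmulL (hDL n) hχ') (memLp_two_of_continuous hf₀c) (hmulL hD₀ hχ')
    (tendsto_eLpNorm_of_tendstoUniformly hunif) (tendsto_eLpNorm_mul_continuous hχ' hDlim)
  have key : ∀ {g E : Torus → ℝ}, Continuous (fun x => pressure W (g x)) → MemLp E 2 →
      (∫ x, (pressure W (g x) + 3 * ε ^ 2 / 2 * E x ^ 2) * χ x) + ε ^ 2 * ∫ x, g x * E x * χ' x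
      = (∫ x, pressure W (g x) * χ x) + 3 * ε ^ 2 / 2 * (∫ x, E x * (E x * χ x))
        + ε ^ 2 * ∫ x, g x * (E x * χ' x) := by
    intro g E hg hE
    have h1 : Integrable fun x => E x * (E x * χ x) := hE.integrable_mul (hmulL hE hχ)
    have h2 : Integrable fun x => pressure W (g x) * χ x := integrable_of_continuous (hg.mul hχ)
    rw [← integral_const_mul (3 * ε ^ 2 / 2), ← integral_add h2 (h1.const_mul _)]
    congr 1
    · exact integral_congr_ae (ae_of_all _ fun x => by simp only; ring)
    · simp only [mul_assoc]
  rw [key hP₀c hD₀]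
  exact ((t1.add (t2.const_mul _)).add (t3.const_mul _)).congr fun n => (key (hPc n) (hDL n)).symm

/-! ### Representation of slope fields -/

/-- A linear functional dominated by the seminorm `v ↦ K ‖R v‖` is represented by a vector of norm
at most `K`. -/
theorem exists_inner_eq_of_abs_le {V H : Type*} [AddCommGroup V] [Module ℝ V]
    [NormedAddCommGroup H] [InnerProductSpace ℝ H] [CompleteSpace H] (R : V →ₗ[ℝ] H)
    (l : V →ₗ[ℝ] ℝ) {K : ℝ} (hK : 0 ≤ K) (hl : ∀ v, |l v| ≤ K * ‖R v‖) :
    ∃ g : H, ‖g‖ ≤ K ∧ ∀ v, l v = inner ℝ g (R v) := by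
  have hker : LinearMap.ker R ≤ LinearMap.ker l := fun v hv => by
    have := hl v
    rw [LinearMap.mem_ker.1 hv, norm_zero, mul_zero] at this
    exact LinearMap.mem_ker.2 (abs_nonpos_iff.1 this)
  -- `l` factors through the range of `R`
  set m : LinearMap.range R →ₗ[ℝ] ℝ :=
    ((LinearMap.ker R).liftQ l hker).comp R.quotKerEquivRange.symm.toLinearMap with hm
  have hmR : ∀ v, m ⟨R v, v, rfl⟩ = l v := fun v => by
    have h1 : R.quotKerEquivRange.symm ⟨R v, v, rfl⟩ = (LinearMap.ker R).mkQ v := by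
      rw [LinearEquiv.symm_apply_eq]
      rfl
    simp only [hm, LinearMap.comp_apply, LinearEquiv.coe_coe, h1]
    rfl
  have hbound : ∀ w, ‖m w‖ ≤ K * ‖w‖ := by
    rintro ⟨-, v, rfl⟩
    rw [hmR]
    exact hl v
  obtain ⟨G, hG, hGn⟩ := exists_extension_norm_eq (LinearMap.range R) (m.mkContinuous K hbound)
  refine ⟨(InnerProductSpace.toDual ℝ H).symm G, ?_, fun v => ?_⟩
  · rw [LinearIsometryEquiv.norm_map, hGn]
    exact LinearMap.mkContinuous_norm_le _ hK _
  · rw [InnerProductSpace.toDual_symm_apply, hG ⟨R v, v, rfl⟩, LinearMap.mkContinuous_apply, hmR]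

/-- The smooth functions on the torus, as a vector space. -/
def testSubmodule : Submodule ℝ (Torus → ℝ) where
  carrier := {φ | IsTest φ}
  add_mem' h h' := IsTest.add h h'
  zero_mem' := IsTest.const 0
  smul_mem' c _ h := IsTest.const_smul c h

/-- Duality: a slope field of norm at most `K` exists as soon as the functional
`φ ↦ stress (φ')` is bounded by `K ‖√f φ‖_{L²}`. -/
theorem exists_mem_slopeFields {W : ℝ → ℝ} (hW : ContDiffOn ℝ 2 W (Ici 0)) {ε : ℝ}
    {f f' D : Torus → ℝ} (hfc : Continuous f) (hf0 : ∀ x, 0 ≤ f x) (hf : f' =ᵐ[volume] f)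
    (hD : weakDeriv f' =ᵐ[volume] D) (hD2 : MemLp D 2) {K : ℝ} (hK : 0 ≤ K)
    (hbound : ∀ φ, IsTest φ →
      |stress W ε f' (torusDeriv φ)| ≤ K * √(∫ x, (√(f x) * φ x) ^ 2)) :
    ∃ g ∈ slopeFields W ε f', eLpNorm g 2 ≤ ENNReal.ofReal K := by
  have hsq : Continuous fun x => √(f x) := hfc.sqrt
  have hPc := continuous_pressure_comp hW hfc hf0
  have hL : ∀ φ : testSubmodule, MemLp (fun x => √(f x) * (φ : Torus → ℝ) x) 2 := fun φ =>
    memLp_two_of_continuous (hsq.mul (IsTest.continuous φ.2))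
  have hQ : Integrable fun x => pressure W (f x) + 3 * ε ^ 2 / 2 * D x ^ 2 :=
    (integrable_of_continuous hPc).add (hD2.integrable_sq.const_mul _)
  have hfD : Integrable fun x => f x * D x :=
    (memLp_continuous_mul hfc hD2).integrable (by norm_num)
  let R : testSubmodule →ₗ[ℝ] Lp ℝ 2 (volume : Measure Torus) :=
    { toFun := fun φ => (hL φ).toLp _
      map_add' := fun φ ψ => by
        rw [← MemLp.toLp_add]
        congr 1
        funext x
        simp [mul_add]
      map_smul' := fun c φ => by
        rw [RingHom.id_apply, ← MemLp.toLp_const_smul]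
        congr 1
        funext x
        simp only [Submodule.coe_smul, Pi.smul_apply, smul_eq_mul]
        ring }
  let l : testSubmodule →ₗ[ℝ] ℝ :=
    { toFun := fun φ => -stress W ε f' (torusDeriv φ)
      map_add' := fun φ ψ => by
        have h1 : torusDeriv ((φ + ψ : testSubmodule) : Torus → ℝ)
            = torusDeriv φ + torusDeriv ψ := IsTest.torusDeriv_add φ.2 ψ.2
        have h2 := IsTest.torusDeriv_add (IsTest.torusDeriv φ.2) (IsTest.torusDeriv ψ.2)
        simp only [stress_eq hf hD]
        rw [h1, h2]
        simp only [Pi.add_apply, mul_add]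
        have c1 := (IsTest.torusDeriv φ.2).continuous
        have c2 := (IsTest.torusDeriv ψ.2).continuous
        have c3 := (IsTest.torusDeriv (IsTest.torusDeriv φ.2)).continuous
        have c4 := (IsTest.torusDeriv (IsTest.torusDeriv ψ.2)).continuous
        rw [integral_add (integrable_mul_continuous hQ c1) (integrable_mul_continuous hQ c2),
          integral_add (integrable_mul_continuous hfD c3) (integrable_mul_continuous hfD c4)]
        ring
      map_smul' := fun c φ => by
        have h1 : torusDeriv ((c • φ : testSubmodule) : Torus → ℝ)
            = c • torusDeriv φ := IsTest.torusDeriv_const_smul c φ.2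
        have h2 := IsTest.torusDeriv_const_smul c (IsTest.torusDeriv φ.2)
        simp only [stress_eq hf hD]
        rw [h1, h2]
        simp only [Pi.smul_apply, smul_eq_mul, mul_left_comm _ c, integral_const_mul,
          RingHom.id_apply]
        ring }
  obtain ⟨g, hgK, hg⟩ := exists_inner_eq_of_abs_le R l hK fun φ => by
    show |-stress W ε f' (torusDeriv φ)| ≤ K * ‖(hL φ).toLp _‖
    rw [abs_neg, norm_toLp_eq]
    exact hbound φ φ.2
  refine ⟨g, ⟨Lp.memLp g, fun φ hφ => ?_⟩, ?_⟩
  · have h1 : -stress W ε f' (torusDeriv φ) = inner ℝ g ((hL ⟨φ, hφ⟩).toLp _) := hg ⟨φ, hφ⟩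
    rw [h1, ← Lp.toLp_coeFn g (Lp.memLp g), inner_toLp (Lp.memLp g)]
    refine integral_congr_ae ?_
    filter_upwards [hf, (Lp.memLp g).coeFn_toLp] with x hx hgx
    rw [hx, hgx]
    ring
  · rw [← Lp.enorm_def, ← ofReal_norm]
    exact ENNReal.ofReal_le_ofReal hgK

/-! ### Identification of the limit measure -/

theorem IsDensity.integral_eq {μ : ProbabilityMeasure Torus} {ρ : Torus → ℝ}
    (h : IsDensity μ ρ) (u : Torus → ℝ) :
    ∫ x, u x ∂(μ : Measure Torus) = ∫ x, ρ x * u x := by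
  rw [h.2.2, integral_withDensity_eq_integral_toReal_smul₀ h.1.ennreal_ofReal
    (ae_of_all _ fun _ => ENNReal.ofReal_lt_top)]
  simp only [ENNReal.toReal_ofReal (h.2.1 _), smul_eq_mul]

theorem IsDensity.density_ae_eq {μ : ProbabilityMeasure Torus} {ρ : Torus → ℝ}
    (h : IsDensity μ ρ) : density μ =ᵐ[volume] ρ := by
  have h1 := Measure.rnDeriv_withDensity₀ (volume : Measure Torus) h.1.ennreal_ofReal
  filter_upwards [h1] with x hx
  rw [density, h.2.2, hx, ENNReal.toReal_ofReal (h.2.1 x)]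

/-- Convergence in the Wasserstein distance implies weak convergence. -/
theorem tendsto_of_wasserstein {μ : ℕ → ProbabilityMeasure Torus} {ν : ProbabilityMeasure Torus}
    (h : Tendsto (fun n => wasserstein (μ n) ν) atTop (𝓝 0)) : Tendsto μ atTop (𝓝 ν) := by
  rw [tendsto_iff_forall_lipschitz_integral_tendsto]
  rintro u - ⟨L, hL⟩
  have hui : ∀ κ : ProbabilityMeasure Torus, Integrable u (κ : Measure Torus) := fun κ =>
    hL.continuous.integrable_of_hasCompactSupport (HasCompactSupport.of_compactSpace u)
  rw [tendsto_iff_edist_tendsto_0]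
  have hplan : ∀ n, ∀ π ∈ transferencePlans (μ n) ν,
      edist (∫ x, u x ∂(μ n : Measure Torus)) (∫ x, u x ∂(ν : Measure Torus))
        ≤ ((L + 1 : ℝ≥0) : ℝ≥0∞)
          * (∫⁻ p, edist p.1 p.2 ^ 2 ∂(π : Measure (Torus × Torus))) ^ (1 / 2 : ℝ) := by
    intro n π hπ
    have hm1 : AEMeasurable (Prod.fst : Torus × Torus → Torus) (π : Measure (Torus × Torus)) :=
      measurable_fst.aemeasurable
    have hm2 : AEMeasurable (Prod.snd : Torus × Torus → Torus) (π : Measure (Torus × Torus)) :=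
      measurable_snd.aemeasurable
    have hi : ∀ v : Torus × Torus → ℝ, Continuous v →
        Integrable v (π : Measure (Torus × Torus)) := fun v hv =>
      hv.integrable_of_hasCompactSupport (HasCompactSupport.of_compactSpace v)
    have hc1 : Continuous fun p : Torus × Torus => u p.1 := hL.continuous.comp continuous_fst
    have hc2 : Continuous fun p : Torus × Torus => u p.2 := hL.continuous.comp continuous_snd
    have h1 : ∫ x, u x ∂(μ n : Measure Torus) - ∫ x, u x ∂(ν : Measure Torus)
        = ∫ p, (u p.1 - u p.2) ∂(π : Measure (Torus × Torus)) := by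
      rw [← hπ.1, ← hπ.2, integral_map hm1 hL.continuous.aestronglyMeasurable,
        integral_map hm2 hL.continuous.aestronglyMeasurable, integral_sub (hi _ hc1) (hi _ hc2)]
    have hdc : Continuous fun p : Torus × Torus => dist p.1 p.2 := continuous_dist
    have h2 : ∀ p : Torus × Torus, ‖dist p.1 p.2‖ₑ = edist p.1 p.2 := fun p => by
      rw [edist_dist, ← ofReal_norm, Real.norm_of_nonneg dist_nonneg]
    have h3 := eLpNorm_le_eLpNorm_of_exponent_le (p := 1) (q := 2) (by norm_num)
      (hdc.aestronglyMeasurable (μ := (π : Measure (Torus × Torus))))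
    rw [eLpNorm_one_eq_lintegral_enorm,
      eLpNorm_eq_lintegral_rpow_enorm_toReal two_ne_zero ENNReal.ofNat_ne_top] at h3
    simp only [h2, ENNReal.toReal_ofNat, ENNReal.rpow_ofNat] at h3
    rw [edist_eq_enorm_sub, h1]
    calc ‖∫ p, (u p.1 - u p.2) ∂(π : Measure (Torus × Torus))‖ₑ
        ≤ ∫⁻ p, ‖u p.1 - u p.2‖ₑ ∂(π : Measure (Torus × Torus)) :=
          enorm_integral_le_lintegral_enorm _
      _ ≤ ∫⁻ p, ((L + 1 : ℝ≥0) : ℝ≥0∞) * edist p.1 p.2 ∂(π : Measure (Torus × Torus)) := by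
          refine lintegral_mono fun p => ?_
          rw [← edist_eq_enorm_sub]
          refine (hL p.1 p.2).trans (mul_le_mul_left ?_ _)
          exact_mod_cast (le_add_of_nonneg_right zero_le_one : L ≤ L + 1)
      _ = ((L + 1 : ℝ≥0) : ℝ≥0∞) * ∫⁻ p, edist p.1 p.2 ∂(π : Measure (Torus × Torus)) :=
          lintegral_const_mul _ (by fun_prop)
      _ ≤ _ := mul_le_mul_right h3 _
  have key : ∀ n, edist (∫ x, u x ∂(μ n : Measure Torus)) (∫ x, u x ∂(ν : Measure Torus))
      ≤ ((L + 1 : ℝ≥0) : ℝ≥0∞) * wasserstein (μ n) ν := by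
    intro n
    have hL0 : ((L + 1 : ℝ≥0) : ℝ≥0∞) ≠ 0 := by simp
    rw [mul_comm, ← ENNReal.div_le_iff hL0 ENNReal.coe_ne_top, wasserstein, one_div,
      ENNReal.le_rpow_inv_iff two_pos]
    refine le_iInf₂ fun π hπ => ?_
    rw [← ENNReal.le_rpow_inv_iff two_pos, ENNReal.div_le_iff hL0 ENNReal.coe_ne_top, mul_comm,
      ← one_div]
    exact hplan n π hπ
  have hlim : Tendsto (fun n => ((L + 1 : ℝ≥0) : ℝ≥0∞) * wasserstein (μ n) ν) atTop (𝓝 0) := by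
    have h0 := ENNReal.Tendsto.const_mul (a := ((L + 1 : ℝ≥0) : ℝ≥0∞)) h
      (Or.inr ENNReal.coe_ne_top)
    rwa [mul_zero] at h0
  exact tendsto_of_tendsto_of_tendsto_of_le_of_le tendsto_const_nhds hlim (fun _ => zero_le) key

/-- If the densities converge uniformly, the Wasserstein limit has the limit density. -/
theorem isDensity_of_tendsto {μ : ℕ → ProbabilityMeasure Torus} {ν : ProbabilityMeasure Torus}
    {ρ : ℕ → Torus → ℝ} {f : Torus → ℝ} (hρ : ∀ n, IsDensity (μ n) (ρ n))
    (hc : ∀ n, Continuous (ρ n)) (hf : Continuous f) (hunif : TendstoUniformly ρ f atTop)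
    (h : Tendsto (fun n => wasserstein (μ n) ν) atTop (𝓝 0)) : IsDensity ν f := by
  have hf0 : ∀ x, 0 ≤ f x := fun x =>
    ge_of_tendsto' (hunif.tendsto_at x) fun n => (hρ n).2.1 x
  have hweak := ProbabilityMeasure.tendsto_iff_forall_integral_tendsto.1 (tendsto_of_wasserstein h)
  have hfin : IsFiniteMeasure ((volume : Measure Torus).withDensity
      fun x => ENNReal.ofReal (f x)) :=
    isFiniteMeasure_withDensity_ofReal (integrable_of_continuous hf).2
  refine ⟨hf.aemeasurable, hf0, ext_of_forall_integral_eq_of_IsFiniteMeasure fun u => ?_⟩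
  have hconst :
      Tendsto (fun _ : ℕ => eLpNorm (⇑u - ⇑u) 2 (volume : Measure Torus)) atTop (𝓝 0) := by
    simp
  have huL := memLp_two_of_continuous u.continuous
  have h1 := tendsto_integral_mul (fun n => memLp_two_of_continuous (hc n)) (fun _ => huL)
    (memLp_two_of_continuous hf) huL (tendsto_eLpNorm_of_tendstoUniformly hunif) hconst
  have h2 := hweak u
  simp only [(hρ _).integral_eq] at h2
  rw [tendsto_nhds_unique h2 h1, integral_withDensity_eq_integral_toReal_smul₀
    hf.aemeasurable.ennreal_ofReal (ae_of_all _ fun _ => ENNReal.ofReal_lt_top)]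
  simp only [ENNReal.toReal_ofReal (hf0 _), smul_eq_mul]

/-! ### Lower semicontinuity -/

/-- The limit of a sequence of measures whose slopes are at most `K` has slope at most `K`. -/
theorem slope_le_of_forall_exists {W : ℝ → ℝ} (hW : ContDiffOn ℝ 2 W (Ici 0)) {ε : ℝ}
    (hε : 0 < ε) {μ : ℕ → ProbabilityMeasure Torus} {μlim : ProbabilityMeasure Torus}
    {ρ : ℕ → Torus → ℝ} (hρ : ∀ n, IsDensity (μ n) (ρ n)) (hcont : ∀ n, Continuous (ρ n))
    (hH2 : ∀ n, MemH2 (ρ n)) {C : ℝ≥0} (hC : ∀ n, h1Seminorm (ρ n) ≤ C)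
    (hlim : Tendsto (fun n => wasserstein (μ n) μlim) atTop (𝓝 0)) {K : ℝ} (hK : 0 ≤ K)
    (hg : ∀ n, ∃ g ∈ slopeFields W ε (density (μ n)), eLpNorm g 2 ≤ ENNReal.ofReal K) :
    slope W ε μlim ≤ ENNReal.ofReal K := by
  choose g hgs hgK using hg
  choose D h hD hh hDae using fun n => (hH2 n).exists_isPrimitive (hcont n)
  have hDL : ∀ n, MemLp (D n) 2 := fun n => memLp_two_of_continuous (hh n).continuous
  have hmass : ∀ n, ∫ x, ρ n x = 1 := fun n => by
    have := (hρ n).integral_eq fun _ => 1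
    simpa using this.symm
  have hDC : ∀ n, ∫ x, D n x ^ 2 ≤ (C : ℝ) ^ 2 := fun n => by
    refine integral_sq_le_of_eLpNorm_le (hDL n) C.2 ?_
    rw [← eLpNorm_congr_ae (hDae n), ENNReal.ofReal_coe_nnreal]
    exact hC n
  have hgC : ∀ n, ∫ x, g n x ^ 2 ≤ K ^ 2 := fun n =>
    integral_sq_le_of_eLpNorm_le (hgs n).1 hK (hgK n)
  obtain ⟨A, hA⟩ := exists_isBoundedProfile hW hε (max ((C : ℝ) ^ 2) (K ^ 2))
  choose T S s hb using fun n => hA (ρ n) (density (μ n)) (D n) (h n) (g n) (hρ n).2.1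
    (hρ n).density_ae_eq (hD n) (hh n) (hgs n) (hmass n) ((hDC n).trans (le_max_left _ _))
    ((hgC n).trans (le_max_right _ _))
  obtain ⟨θ, f, D₀, hθ, hf, hf0, hD₀, hweak, hunif, hDlim⟩ := exists_subseq_tendsto hW hε hb
  have hdens : IsDensity μlim f :=
    isDensity_of_tendsto (fun n => hρ (θ n)) (fun n => hcont (θ n)) hf hunif
      (hlim.comp hθ.tendsto_atTop)
  have hae := hdens.density_ae_eq
  have hweak' : HasWeakDeriv (density μlim) D₀ := hweak.congr_ae hae.symm (ae_eq_refl _)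
  have hDae₀ := hweak'.weakDeriv_ae_eq
  have hH1 : MemH1 (density μlim) :=
    ⟨(memLp_two_of_continuous hf).ae_eq hae.symm, hasWeakDeriv_weakDeriv hweak',
      hD₀.ae_eq hDae₀.symm⟩
  have hac : (μlim : Measure Torus) ≪ volume := by
    rw [hdens.2.2]
    exact withDensity_absolutelyContinuous _ _
  have hbound : ∀ φ, IsTest φ → |stress W ε (density μlim) (torusDeriv φ)|
      ≤ K * √(∫ x, (√(f x) * φ x) ^ 2) := by
    intro φ hφ
    have hsqL : ∀ {u : Torus → ℝ}, Continuous u → MemLp (fun x => √(u x) * φ x) 2 := fun hu =>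
      memLp_two_of_continuous (hu.sqrt.mul hφ.continuous)
    have hsq : ∀ {u : Torus → ℝ}, (∀ x, 0 ≤ u x) →
        ∫ x, (√(u x) * φ x) ^ 2 = ∫ x, u x * φ x ^ 2 := fun hu => by
      simp only [mul_pow, Real.sq_sqrt (hu _)]
    have hφ2 : MemLp (fun x => φ x ^ 2) 2 := memLp_two_of_continuous (hφ.continuous.pow 2)
    have h1 := tendsto_stress hW ε (fun n => hcont (θ n)) (fun n => (hρ (θ n)).2.1)
      (fun n => (hb (θ n)).le) hf (fun n => hDL (θ n)) hD₀ hunif hDlim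
      hφ.torusDeriv.continuous hφ.torusDeriv.torusDeriv.continuous
    rw [← stress_eq hae hDae₀] at h1
    have h2 := tendsto_integral_mul (fun n => memLp_two_of_continuous (hcont (θ n)))
      (fun _ => hφ2) (memLp_two_of_continuous hf) hφ2
      (tendsto_eLpNorm_of_tendstoUniformly hunif) (by simp)
    rw [hsq hf0]
    refine le_of_tendsto_of_tendsto' h1.abs (h2.sqrt.const_mul K) fun n => ?_
    have h3 : weakDeriv (density (μ (θ n))) =ᵐ[volume] D (θ n) :=
      ((hD (θ n)).hasWeakDeriv.congr_ae (hρ (θ n)).density_ae_eq.symm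
        (ae_eq_refl _)).weakDeriv_ae_eq
    rw [← stress_eq (hρ (θ n)).density_ae_eq h3, ← abs_neg, (hgs (θ n)).2 φ hφ,
      ← hsq (hρ (θ n)).2.1]
    have h4 : ∫ x, √(density (μ (θ n)) x) * g (θ n) x * φ x
        = ∫ x, g (θ n) x * (√(ρ (θ n) x) * φ x) := by
      refine integral_congr_ae ?_
      filter_upwards [(hρ (θ n)).density_ae_eq] with x hx
      rw [hx]; ring
    rw [h4]
    refine (abs_integral_mul_le (hgs (θ n)).1 (hsqL (hcont (θ n)))).trans ?_
    exact mul_le_mul_of_nonneg_right ((Real.sqrt_le_left hK).2 (hgC (θ n))) (Real.sqrt_nonneg _)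
  obtain ⟨g₀, hg₀, hg₀K⟩ := exists_mem_slopeFields hW hf hf0 hae hDae₀ hD₀ hK hbound
  rw [slope, if_pos ⟨hac, hH1⟩]
  exact (iInf₂_le g₀ hg₀).trans hg₀K

end ThinFilm

end

theorem lemmaB1
    (W : ℝ → ℝ) (hW : ContDiffOn ℝ 2 W (Set.Ici 0)) (hW0 : ∀ y : ℝ, 0 ≤ y → 0 ≤ W y)
    (ε : ℝ) (hε : 0 < ε)
    (μ : ℕ → ProbabilityMeasure ThinFilm.Torus) (μlim : ProbabilityMeasure ThinFilm.Torus)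
    (ρ : ℕ → ThinFilm.Torus → ℝ)
    (hρ : ∀ n, ThinFilm.IsDensity (μ n) (ρ n))
    (hcont : ∀ n, Continuous (ρ n))
    (hH2 : ∀ n, ThinFilm.MemH2 (ρ n))
    (hC3 : ∀ n, ContDiffOn ℝ 3 (fun t : ℝ => ρ n (t : ThinFilm.Torus))
      {t : ℝ | 0 < ρ n (t : ThinFilm.Torus)})
    (C : ℝ≥0) (hC : ∀ n, ThinFilm.h1Seminorm (ρ n) ≤ C)
    (hlim : Tendsto (fun n => ThinFilm.wasserstein (μ n) μlim) atTop (𝓝 0)) :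
    ThinFilm.slope W ε μlim ≤ liminf (fun n => ThinFilm.slope W ε (μ n)) atTop := by
  refine le_of_forall_gt_imp_ge_of_dense fun K hK => ?_
  rcases eq_or_ne K ⊤ with rfl | hKtop
  · exact le_top
  obtain ⟨θ, hθ, hθK⟩ :=
    extraction_of_frequently_atTop (frequently_lt_of_liminf_lt (by isBoundedDefault) hK)
  rw [← ENNReal.ofReal_toReal hKtop]
  refine ThinFilm.slope_le_of_forall_exists hW hε (fun n => hρ (θ n)) (fun n => hcont (θ n))
    (fun n => hH2 (θ n)) (fun n => hC (θ n)) (hlim.comp hθ.tendsto_atTop)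
    ENNReal.toReal_nonneg fun n => ?_
  have h1 := hθK n
  rw [ThinFilm.slope] at h1
  split_ifs at h1
  · simp only [iInf_lt_iff] at h1
    obtain ⟨g, hg, hgK⟩ := h1
    exact ⟨g, hg, by rw [ENNReal.ofReal_toReal hKtop]; exact hgK.le⟩
  · exact absurd h1 not_top_lt
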